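/- Let $(G,\chi)$ be a vertex-colored graph: $G$ is a finite, non-empty, simple undirected graph and $\chi\colon V(G)\to C$ is any map into a set $C$ of colors (an uncolored graph is the case of a constant coloring). For $k\ge 1$, the $k$-dimensional Weisfeiler–Leman algorithm ($k$-WL) colors the $k$-tuples of vertices as follows. Initially, $\bar v=(v_1,\dots,v_k)$ is colored by $\mathrm{wl}_0(\bar v)$, the isomorphism type of the ordered colored subgraph induced by $v_1,\dots,v_k$. If $k\ge 2$, then in each round $$\mathrm{wl}_{i+1}(\bar v)=\Big(\mathrm{wl}_i(\bar v),\ \{\!\!\{(\mathrm{wl}_i(\bar v[w/1]),\dots,\mathrm{wl}_i(\bar v[w/k]))\mid w\in V(G)\}\!\!\}\Big),$$ where $\bar v[w/j]$ is obtained from $\bar v$ by replacing the $j$-th entry with $w$; for $k=1$ the multiset is $\{\!\!\{\mathrm{wl}_i(w)\mid w\in N_G(v)\}\!\!\}$ instead. Let $i_\infty$ be the least $i$ such that $\mathrm{wl}_i$ and $\mathrm{wl}_{i+1}$ induce the same partition of $V(G)^k$; the output of $k$-WL is the coloring $\mathrm{wl}_{i_\infty+1}$. $k$-WL distinguishes two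 colored graphs if the multisets of colors of all $k$-tuples in the two outputs differ, and it identifies $(G,\chi)$ if it distinguishes $(G,\chi)$ from every vertex-colored graph that is not isomorphic to it (isomorphisms preserve colors). The WL dimension of $(G,\chi)$ is the least $k\ge 1$ such that $k$-WL identifies $(G,\chi)$. Theorem. There is a function $f\colon\mathbb N\to\mathbb R$ with $f(n)=o(n)$ as $n\to\infty$ such that every vertex-colored graph $(G,\chi)$ with $n$ vertices has (finite) WL dimension at most $\frac n4+f(n)$. In particular, every $n$-vertex graph has WL dimension at most $\frac n4+o(n)$. -/

import Mathlib

open Filter Asymptotics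

universe u v

namespace WL

/-- The isomorphism type of an ordered `k`-tuple of vertices of a colored graph: the colors of the
entries, which entries coincide, and which entries are adjacent. -/
abbrev AtomicType (k : ℕ) (C : Type v) : Type v :=
  (Fin k → C) × (Fin k → Fin k → Prop) × (Fin k → Fin k → Prop)

/-- The colors available after `i` rounds of `k`-WL. They do not depend on the graph, so that
colors of tuples of different graphs can be compared. -/
def Color (k : ℕ) (C : Type v) : ℕ → Type v
  | 0 => AtomicType k C
  | i + 1 => Color k C i × Multiset (Fin k → Color k C i)

section

variable {V : Type u} {C : Type v}

/-- The isomorphism type of the tuple `x` in the colored graph `(G, χ)`. -/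
def atomicType {k : ℕ} (G : SimpleGraph V) (χ : V → C) (x : Fin k → V) : AtomicType k C :=
  (fun i => χ (x i), fun i j => x i = x j, fun i j => G.Adj (x i) (x j))

/-- Two tuples have the same atomic type iff mapping one to the other entry by entry is an
isomorphism between the induced colored subgraphs. -/
theorem atomicType_eq_iff {W : Type u} {k : ℕ} (G : SimpleGraph V) (χ : V → C)
    (H : SimpleGraph W) (ψ : W → C) (x : Fin k → V) (y : Fin k → W) :
    atomicType G χ x = atomicType H ψ y ↔
      ∃ e : G.induce (Set.range x) ≃g H.induce (Set.range y),
        (∀ i, (e ⟨x i, Set.mem_range_self i⟩ : W) = y i) ∧ ∀ z, ψ (e z) = χ z := by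
  constructor
  · intro h
    simp only [atomicType, Prod.mk.injEq, funext_iff, eq_iff_iff] at h
    obtain ⟨h1, h2, h3⟩ := h
    choose p hp using fun z : Set.range x => z.2
    choose q hq using fun z : Set.range y => z.2
    refine ⟨⟨⟨fun z => ⟨y (p z), Set.mem_range_self _⟩, fun z => ⟨x (q z), Set.mem_range_self _⟩,
      ?_, ?_⟩, ?_⟩, ?_, ?_⟩
    · intro z
      apply Subtype.ext
      change x (q _) = z
      rw [← hp z, h2]
      exact hq ⟨y (p z), Set.mem_range_self _⟩
    · intro z
      apply Subtype.ext
      change y (p _) = z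
      rw [← hq z, ← h2]
      exact hp ⟨x (q z), Set.mem_range_self _⟩
    · intro a b
      change H.Adj (y (p a)) (y (p b)) ↔ G.Adj a b
      rw [← h3, hp, hp]
    · intro i
      change y (p _) = y i
      rw [← h2]
      exact hp ⟨x i, Set.mem_range_self i⟩
    · intro z
      change ψ (y (p z)) = χ z
      rw [← h1, hp]
  · rintro ⟨e, he, hc⟩
    simp only [atomicType, Prod.mk.injEq, funext_iff, eq_iff_iff]
    refine ⟨fun i => ?_, fun i j => ?_, fun i j => ?_⟩
    · rw [← he, hc]
    · rw [← he i, ← he j, ← Subtype.ext_iff, e.injective.eq_iff, Subtype.mk.injEq]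
    · rw [← he i, ← he j]
      exact (e.map_rel_iff (a := ⟨x i, Set.mem_range_self i⟩)
        (b := ⟨x j, Set.mem_range_self j⟩)).symm

/-- `c₁` refines `c₂`. -/
def Refines {T A B : Type*} (c₁ : T → A) (c₂ : T → B) : Prop :=
  ∀ s t, c₁ s = c₁ t → c₂ s = c₂ t

/-- The two colorings induce the same partition. -/
def Equivalent {T A B : Type*} (c₁ : T → A) (c₂ : T → B) : Prop :=
  Refines c₁ c₂ ∧ Refines c₂ c₁

variable [Fintype V]

open Classical in
/-- The vertices that are substituted into the tuple `x` in one round of `k`-WL: all vertices,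
except that for `k = 1` only the neighbors of the single entry of `x` are considered. -/
noncomputable def substitutes {k : ℕ} (G : SimpleGraph V) (x : Fin k → V) : Finset V :=
  if k = 1 then Finset.univ.filter (fun w => ∀ j, G.Adj (x j) w) else Finset.univ

/-- The coloring of `k`-tuples computed by `i` rounds of `k`-WL on `(G, χ)`. -/
noncomputable def roundColoring (k : ℕ) (G : SimpleGraph V) (χ : V → C) :
    (i : ℕ) → (Fin k → V) → Color k C i
  | 0, x => atomicType G χ x
  | i + 1, x =>
    (roundColoring k G χ i x,
      (substitutes G x).val.map fun w => fun j => roundColoring k G χ i (Function.update x j w))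

/-- The least `i` such that round `i + 1` does not properly refine round `i`. -/
noncomputable def stableRound (k : ℕ) (G : SimpleGraph V) (χ : V → C) : ℕ :=
  sInf {i | Equivalent (roundColoring k G χ i) (roundColoring k G χ (i + 1))}

/-- The set in the definition of `stableRound` is nonempty. -/
theorem exists_stableRound (k : ℕ) (G : SimpleGraph V) (χ : V → C) :
    {i | Equivalent (roundColoring k G χ i) (roundColoring k G χ (i + 1))}.Nonempty := by
  classical
  let S : ℕ → Set ((Fin k → V) × (Fin k → V)) :=
    fun i => {p | roundColoring k G χ i p.1 = roundColoring k G χ i p.2}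
  have hS : ∀ i, S (i + 1) ⊆ S i := fun i p hp => congrArg Prod.fst hp
  obtain ⟨n, hn⟩ := WellFoundedGT.monotone_chain_condition
    (α := (Set ((Fin k → V) × (Fin k → V)))ᵒᵈ)
    ⟨fun i => OrderDual.toDual (S i), monotone_nat_of_le_succ fun i => hS i⟩
  have h : S n = S (n + 1) := hn (n + 1) (Nat.le_succ n)
  exact ⟨n, fun s t hst => (Set.ext_iff.1 h (s, t)).1 hst,
    fun s t hst => (Set.ext_iff.1 h (s, t)).2 hst⟩

/-- The coloring of `k`-tuples computed by `k`-WL on `(G, χ)`. -/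
noncomputable def coloring (k : ℕ) (G : SimpleGraph V) (χ : V → C) (x : Fin k → V) :
    Σ i, Color k C i :=
  ⟨stableRound k G χ + 1, roundColoring k G χ (stableRound k G χ + 1) x⟩

/-- `k`-WL distinguishes the colored graphs `(G, χ)` and `(H, ψ)`. -/
def Distinguishes (k : ℕ) (G : SimpleGraph V) (χ : V → C)
    {W : Type u} [Fintype W] (H : SimpleGraph W) (ψ : W → C) : Prop :=
  (Finset.univ : Finset (Fin k → V)).val.map (coloring k G χ) ≠
    (Finset.univ : Finset (Fin k → W)).val.map (coloring k H ψ)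

/-- `k`-WL identifies the colored graph `(G, χ)`: it distinguishes it from every colored graph
that is not isomorphic to it. -/
def Identifies (k : ℕ) (G : SimpleGraph V) (χ : V → C) : Prop :=
  ∀ (W : Type u) [Fintype W] [Nonempty W] (H : SimpleGraph W) (ψ : W → C),
    (¬ ∃ φ : G ≃g H, ∀ x, ψ (φ x) = χ x) → Distinguishes k G χ H ψ

/-- The Weisfeiler–Leman dimension of `(G, χ)`: the least `k ≥ 1` such that `k`-WL identifies
`(G, χ)` (and `⊤` if there were none). -/
noncomputable def dimension (G : SimpleGraph V) (χ : V → C) : ℕ∞ :=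
  sInf {d : ℕ∞ | ∃ k : ℕ, d = k ∧ 1 ≤ k ∧ Identifies k G χ}

end

end WL

/-! If `k`-WL fails to distinguish two graphs, Duplicator wins a bijective game with `k` pebble
pairs, so it suffices that few pebbles reconstruct the graph. A pebble parked on a vertex
individualizes it, and three free pebbles can follow the passage to the coherent closure. Hence one
may work in coherent configurations and individualize vertices at the price of one pebble each.

The term n/4 comes from a greedy process: as long as some nonempty set S of vertices yields at least
4|S| new fibers, individualize it. There are at most n fibers, so this costs at most n/4 pebbles
(`Coherent.identified`). It ends in a `Stuck` configuration, for which o(n) pebbles must suffice.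

Being stuck is restrictive. Join two fibers if several basis relations run between them. A fiber
with three neighbors or a path of four fibers would permit a profitable individualization, the path
because of Fisher's inequality (`Stuck.no_star`, `Stuck.no_path`). So components have at most three
fibers, and they can be treated separately (`Identified.of_components`).

With at most three fibers, the symmetric differences of neighborhoods within a fiber have at most
twelve sizes, so some gap between widely spaced scales contains none of them. Individualizing a
small hitting set separates all pairs above the gap. The new fibers then consist of near twins, and
complementing adjacency between densely joined fibers leaves a graph of small degree. Many far-apart
vertices with long paths around them would be profitable again, at five fibers per pebble. So the
components of this sparse graph are small, and a component is identified by as many pebbles as it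
has vertices (`Stuck.identified_of_gap`). Between such components the fibers determine adjacency but
not the full color of a pair, which is why `Identified` asks only for vertex colors and `γ`. -/

namespace Rainbow

/-! ### The bijective pebble game, coherent closure and individualization -/

/-- `R` is a back-and-forth system of positions of the bijective game with `k` pebble pairs, played
on two edge-colored complete digraphs. -/
structure IsBisim {V W : Type u} {K : Type v} (k : ℕ) (c : V → V → K) (d : W → W → K)
    (R : (Fin k → V) → (Fin k → W) → Prop) : Prop where
  color : ∀ x y, R x y → ∀ i j, c (x i) (x j) = d (y i) (y j)
  eq : ∀ x y, R x y → ∀ i j, x i = x j ↔ y i = y j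
  step : ∀ x y, R x y → ∃ σ : V ≃ W, ∀ w i,
    R (Function.update x i w) (Function.update y i (σ w))

/-- Duplicator wins the bijective game with `k` pebble pairs. -/
def PebbleEquiv {V W : Type u} {K : Type v} (k : ℕ) (c : V → V → K) (d : W → W → K) : Prop :=
  ∃ R, IsBisim k c d R ∧ ∃ x y, R x y

/-- Every structure equivalent to `c` admits a bijection that preserves the colors of vertices and
the binary relation `γ` on colors of pairs. -/
def Identified {V : Type u} {K : Type v} (k : ℕ) (c : V → V → K) (γ : K → Prop) : Prop :=
  ∀ (W : Type u) (d : W → W → K), PebbleEquiv k c d →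
    ∃ φ : V ≃ W, (∀ u, d (φ u) (φ u) = c u u) ∧ ∀ u v, γ (d (φ u) (φ v)) ↔ γ (c u v)

/-- The coloring `c'` refines `c`. -/
def Finer {V : Type u} {K K' : Type v} (c' : V → V → K') (c : V → V → K) : Prop :=
  ∀ u v u' v', c' u v = c' u' v' → c u v = c u' v'

/-- A coherent configuration, given by the colors of its basis relations. -/
structure Coherent {V : Type u} {K : Type v} (c : V → V → K) : Prop where
  diag : ∀ u v w, c u v = c w w → u = v
  symm : ∀ u v u' v', c u v = c u' v' → c v u = c v' u'
  perm : ∀ u v u' v', c u v = c u' v' →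
    ∃ σ : V ≃ V, ∀ w, c u w = c u' (σ w) ∧ c w v = c (σ w) v'

/-- The coloring `c` with the vertex `v` marked. -/
def mark {V : Type u} {K : Type v} (c : V → V → K) (v : V) : V → V → K × Prop × Prop :=
  fun u w => (c u w, u = v, w = v)

/-- One round of 2-dimensional refinement. -/
noncomputable def refine {V : Type u} {K : Type v} (c : V → V → K) :
    V → V → K × K × (K → K → ℕ) :=
  fun u v => (c u v, c v u, fun a b => Nat.card {w // c u w = a ∧ c w v = b})

section

variable {V W : Type u} {K K' : Type v} {k : ℕ}

theorem IsBisim.flip {c : V → V → K} {d : W → W → K} {R : (Fin k → V) → (Fin k → W) → Prop}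
    (h : IsBisim k c d R) : IsBisim k d c (fun y x => R x y) where
  color y x hR i j := (h.color x y hR i j).symm
  eq y x hR i j := (h.eq x y hR i j).symm
  step y x hR := by
    obtain ⟨σ, hσ⟩ := h.step x y hR
    refine ⟨σ.symm, fun w i => ?_⟩
    simpa using hσ (σ.symm w) i

/-- Spoiler moves the pebbles to their targets one at a time, and Duplicator's bijections supply the
answers. -/
theorem IsBisim.total {c : V → V → K} {d : W → W → K} {R : (Fin k → V) → (Fin k → W) → Prop}
    (h : IsBisim k c d R) (hne : ∃ x y, R x y) (x' : Fin k → V) : ∃ y', R x' y' := by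
  classical
  obtain ⟨x, y, hR⟩ := hne
  have key : ∀ s : Finset (Fin k), ∃ y', R (fun i => if i ∈ s then x' i else x i) y' := by
    intro s
    induction s using Finset.induction_on with
    | empty => exact ⟨y, by simpa using hR⟩
    | insert a s _ ih =>
      obtain ⟨y', hy'⟩ := ih
      obtain ⟨σ, hσ⟩ := h.step _ _ hy'
      refine ⟨Function.update y' a (σ (x' a)), ?_⟩
      convert hσ (x' a) a using 1
      funext i
      by_cases hi : i = a
      · subst hi; simp
      · simp [hi]
  obtain ⟨y', hy'⟩ := key Finset.univ
  exact ⟨y', by simpa using hy'⟩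

theorem PebbleEquiv.comp {c : V → V → K} {d : W → W → K} (h : PebbleEquiv k c d) (π : K → K') :
    PebbleEquiv k (fun u v => π (c u v)) (fun u v => π (d u v)) := by
  obtain ⟨R, hR, hne⟩ := h
  exact ⟨R, ⟨fun x y hxy i j => congrArg π (hR.color x y hxy i j), hR.eq, hR.step⟩, hne⟩

/-- Pebble 0 is left on `v` for the rest of the game. Equality with its position is preserved, so
the remaining pebbles see the mark. -/
theorem PebbleEquiv.mark {c : V → V → K} {d : W → W → K} (h : PebbleEquiv (k + 1) c d) (v : V) :
    ∃ w, PebbleEquiv k (mark c v) (mark d w) := by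
  obtain ⟨R, hR, hne⟩ := h
  obtain ⟨y, hy⟩ := hR.total hne (fun _ => v)
  refine ⟨y 0, fun x z => R (Fin.cons v x) (Fin.cons (y 0) z), ⟨?_, ?_, ?_⟩, fun _ => v,
    Fin.tail y, ?_⟩
  · intro x z hxz i j
    have h1 := hR.color _ _ hxz i.succ j.succ
    have h2 := hR.eq _ _ hxz i.succ 0
    have h3 := hR.eq _ _ hxz j.succ 0
    simp only [Fin.cons_succ, Fin.cons_zero] at h1 h2 h3
    simp [Rainbow.mark, h1, h2, h3]
  · intro x z hxz i j
    simpa using hR.eq _ _ hxz i.succ j.succ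
  · intro x z hxz
    obtain ⟨σ, hσ⟩ := hR.step _ _ hxz
    refine ⟨σ, fun w i => ?_⟩
    simpa [Fin.cons_update] using hσ w i.succ
  · change R (Fin.cons v fun _ => v) (Fin.cons (y 0) (Fin.tail y))
    rw [Fin.cons_self_tail]
    convert hy using 1
    funext i
    cases i using Fin.cases <;> simp

theorem PebbleEquiv.of_succ {c : V → V → K} {d : W → W → K} [Nonempty V]
    (h : PebbleEquiv (k + 1) c d) : PebbleEquiv k c d := by
  obtain ⟨w, hw⟩ := h.mark (Classical.arbitrary V)
  exact hw.comp Prod.fst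

/-- With `k ≥ 3` there is a pebble `l` away from `i` and `j`. Moving it over all vertices,
Duplicator's bijection matches the triangles over the two pebbled pairs. -/
theorem PebbleEquiv.refine {c : V → V → K} {d : W → W → K} (hk : 3 ≤ k)
    (h : PebbleEquiv k c d) : PebbleEquiv k (refine c) (refine d) := by
  classical
  obtain ⟨R, hR, hne⟩ := h
  refine ⟨R, ⟨?_, hR.eq, hR.step⟩, hne⟩
  intro x y hxy i j
  obtain ⟨l, hl⟩ : ∃ l, l ∉ ({i, j} : Finset (Fin k)) := by
    by_contra! hall
    have h1 : (Finset.univ : Finset (Fin k)).card ≤ ({i, j} : Finset (Fin k)).card :=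
      Finset.card_le_card fun l _ => hall l
    have h2 := Finset.card_le_two (a := i) (b := j)
    simp at h1
    omega
  simp only [Finset.mem_insert, Finset.mem_singleton, not_or] at hl
  obtain ⟨σ, hσ⟩ := hR.step x y hxy
  have h1 : ∀ w, c (x i) w = d (y i) (σ w) := fun w => by
    simpa [Function.update_of_ne (Ne.symm hl.1)] using hR.color _ _ (hσ w l) i l
  have h2 : ∀ w, c w (x j) = d (σ w) (y j) := fun w => by
    simpa [Function.update_of_ne (Ne.symm hl.2)] using hR.color _ _ (hσ w l) l j
  simp only [Rainbow.refine, Prod.mk.injEq]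
  refine ⟨hR.color x y hxy i j, hR.color x y hxy j i, ?_⟩
  funext a b
  exact Nat.card_congr (σ.subtypeEquiv fun w => by rw [h1, h2])

theorem Identified.succ [Nonempty V] {c : V → V → K} {γ : K → Prop} (h : Identified k c γ) :
    Identified (k + 1) c γ := fun W d hd => h W d hd.of_succ

theorem Identified.mono [Nonempty V] {c : V → V → K} {γ : K → Prop} {l : ℕ}
    (h : Identified k c γ) (hkl : k ≤ l) : Identified l c γ := by
  induction l, hkl using Nat.le_induction with
  | base => exact h
  | succ l _ ih => exact ih.succ

theorem Identified.of_mark {c : V → V → K} {γ : K → Prop} (v : V)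
    (h : Identified k (mark c v) (fun a => γ a.1)) : Identified (k + 1) c γ := by
  intro W d hd
  obtain ⟨w, hw⟩ := hd.mark v
  obtain ⟨φ, h1, h2⟩ := h W _ hw
  exact ⟨φ, fun u => congrArg Prod.fst (h1 u), h2⟩

theorem Coherent.left {c : V → V → K} (hc : Coherent c) {u v u' v' : V}
    (h : c u v = c u' v') : c u u = c u' u' := by
  obtain ⟨σ, hσ⟩ := hc.perm _ _ _ _ h
  have h1 := (hσ u).1
  have h2 := hc.diag _ _ _ h1.symm
  rw [h1, ← h2]

theorem Coherent.right {c : V → V → K} (hc : Coherent c) {u v u' v' : V}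
    (h : c u v = c u' v') : c v v = c v' v' :=
  hc.left (hc.symm _ _ _ _ h)

/-- Equal intersection numbers give a bijection for each pair of colors. Gluing these yields the
single bijection in `Coherent.perm`, a form in which later counts transfer directly. -/
theorem coherent_of_refine [Finite V] {c : V → V → K} (hd : ∀ u v w, c u v = c w w → u = v)
    (h : Finer c (refine c)) : Coherent c where
  diag := hd
  symm u v u' v' huv := by
    have := h u v u' v' huv
    simp only [refine, Prod.mk.injEq] at this
    exact this.2.1
  perm u v u' v' huv := by
    have := h u v u' v' huv
    simp only [refine, Prod.mk.injEq] at this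
    have h3 := this.2.2
    have h4 : ∀ a : K × K, Nonempty ({w // (c u w, c w v) = a} ≃ {w // (c u' w, c w v') = a}) := by
      rintro ⟨a, b⟩
      have := congrFun (congrFun h3 a) b
      simp only [Prod.mk.injEq]
      exact Finite.card_eq.1 this
    let e := fun a => (h4 a).some
    refine ⟨Equiv.ofFiberEquiv e, fun w => ?_⟩
    have := Equiv.ofFiberEquiv_map e w
    simp only [Prod.mk.injEq] at this
    exact ⟨this.1.symm, this.2.symm⟩

theorem Finer.refine {K'' : Type v} {c : V → V → K} {c'' : V → V → K''}
    (hc : Coherent c'') (h : Finer c'' c) : Finer c'' (Rainbow.refine c) := by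
  intro u v u' v' huv
  simp only [Rainbow.refine, Prod.mk.injEq]
  refine ⟨h _ _ _ _ huv, h _ _ _ _ (hc.symm _ _ _ _ huv), ?_⟩
  obtain ⟨σ, hσ⟩ := hc.perm _ _ _ _ huv
  funext a b
  exact Nat.card_congr (σ.subtypeEquiv fun w => by
    rw [h _ _ _ _ (hσ w).1, h _ _ _ _ (hσ w).2])

/-- `c'` is obtained from `c` by a transformation that `k` pebbles can follow for all `k ≥ 3`, and
it is coarser than every coherent configuration that refines `c`. -/
structure IsClosure (c : V → V → K) (c' : V → V → K') (π : K' → K) : Prop where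
  coherent : Coherent c'
  proj : ∀ u v, π (c' u v) = c u v
  lift : ∀ k, 3 ≤ k → ∀ (W : Type u) (d : W → W → K), PebbleEquiv k c d →
    ∃ d' : W → W → K', PebbleEquiv k c' d' ∧ ∀ a b, π (d' a b) = d a b
  coarsest : ∀ (K'' : Type v) (c'' : V → V → K''), Coherent c'' → Finer c'' c → Finer c'' c'

/-- A refinement round that is not stable creates a new color, and there are at most `Nat.card (V ×
V)` of them; `m` bounds the number still missing. -/
theorem exists_closure_aux [Finite V] (m : ℕ) : ∀ (K : Type v) (c : V → V → K),
    (∀ u v w, c u v = c w w → u = v) →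
    Nat.card (V × V) ≤ m + (Set.range fun p : V × V => c p.1 p.2).ncard →
    ∃ (K' : Type v) (c' : V → V → K') (π : K' → K), IsClosure c c' π := by
  induction m with
  | zero =>
    intro K c hd hm
    refine ⟨K, c, id, coherent_of_refine hd ?_, fun _ _ => rfl,
      fun k hk W d h => ⟨d, h, fun _ _ => rfl⟩, fun _ _ _ h => h⟩
    have hinj : Set.InjOn (fun p : V × V => c p.1 p.2) Set.univ := by
      apply Set.injOn_of_ncard_image_eq _ Set.finite_univ
      apply le_antisymm (Set.ncard_image_le Set.finite_univ)
      rw [Set.image_univ, Set.ncard_univ]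
      omega
    intro u v u' v' h
    have := hinj (Set.mem_univ (u, v)) (Set.mem_univ (u', v')) h
    simp only [Prod.mk.injEq] at this
    rw [this.1, this.2]
  | succ m ih =>
    intro K c hd hm
    by_cases h : Finer c (refine c)
    · exact ⟨K, c, id, coherent_of_refine hd h, fun _ _ => rfl,
        fun k hk W d h => ⟨d, h, fun _ _ => rfl⟩, fun _ _ _ h => h⟩
    · have himg : (Set.range fun p : V × V => c p.1 p.2) =
          Prod.fst '' (Set.range fun p : V × V => refine c p.1 p.2) := by
        rw [← Set.range_comp]; rfl
      have hfin : (Set.range fun p : V × V => refine c p.1 p.2).Finite := Set.finite_range _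
      have hlt : (Set.range fun p : V × V => c p.1 p.2).ncard <
          (Set.range fun p : V × V => refine c p.1 p.2).ncard := by
        rw [himg]
        refine lt_of_le_of_ne (Set.ncard_image_le hfin) fun heq => h ?_
        have hinj := Set.injOn_of_ncard_image_eq heq hfin
        intro u v u' v' huv
        exact hinj ⟨(u, v), rfl⟩ ⟨(u', v'), rfl⟩ huv
      obtain ⟨K', c', π, hc⟩ := ih _ (refine c)
        (fun u v w huv => hd u v w (congrArg Prod.fst huv)) (by omega)
      refine ⟨K', c', fun a => (π a).1, hc.coherent, fun u v => congrArg Prod.fst (hc.proj u v),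
        fun k hk W d hkd => ?_, fun K'' c'' h1 h2 => hc.coarsest K'' c'' h1 (h2.refine h1)⟩
      obtain ⟨d', h1, h2⟩ := hc.lift k hk W _ (hkd.refine hk)
      exact ⟨d', h1, fun a b => congrArg Prod.fst (h2 a b)⟩

theorem exists_closure [Finite V] (c : V → V → K) (hd : ∀ u v w, c u v = c w w → u = v) :
    ∃ (K' : Type v) (c' : V → V → K') (π : K' → K), IsClosure c c' π :=
  exists_closure_aux (Nat.card (V × V)) K c hd (by omega)

theorem IsClosure.identified {c : V → V → K} {c' : V → V → K'} {π : K' → K}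
    (h : IsClosure c c' π) {γ : K → Prop} (hk : 3 ≤ k) (hI : Identified k c' fun a => γ (π a)) :
    Identified k c γ := by
  intro W d hd
  obtain ⟨d', h1, h2⟩ := h.lift k hk W d hd
  obtain ⟨φ, h3, h4⟩ := hI W d' h1
  refine ⟨φ, fun u => ?_, fun u v => ?_⟩
  · rw [← h2, h3, h.proj]
  · rw [← h2, ← h.proj]; exact h4 u v

/-- Every vertex of `S` has a color of its own. -/
def Separates (c : V → V → K) (S : Finset V) : Prop :=
  ∀ s ∈ S, ∀ u, c u u = c s s → u = s

/-- Mark the vertices of `S` in turn, taking the coherent closure after each. The minimality clause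
makes this comparable with a refinement obtained by other means, such as the one provided by
`Stuck`. -/
theorem exists_individualized [Finite V] {c : V → V → K} (hc : Coherent c) (S : Finset V) :
    ∃ (K' : Type v) (c' : V → V → K') (π : K' → K), Coherent c' ∧ (∀ u v, π (c' u v) = c u v) ∧
      Separates c' S ∧
      (∀ k (γ : K → Prop), 3 ≤ k → Identified k c' (fun a => γ (π a)) →
        Identified (k + S.card) c γ) ∧
      ∀ (K'' : Type v) (c'' : V → V → K''), Coherent c'' → Finer c'' c → Separates c'' S →
        Finer c'' c' := by
  classical
  induction S using Finset.induction_on with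
  | empty =>
    exact ⟨K, c, id, hc, fun _ _ => rfl, by simp [Separates], fun k γ _ h => h,
      fun _ _ _ h _ => h⟩
  | insert v S hv ih =>
    obtain ⟨K₁, c₁, π₁, h1, h2, h3, h4, h5⟩ := ih
    obtain ⟨K₂, c₂, π₂, hcl⟩ := exists_closure (mark c₁ v)
      (fun u w z h => h1.diag u w z (congrArg Prod.fst h))
    have hf : ∀ a b, (π₂ (c₂ a b)).1 = c₁ a b := fun a b => congrArg Prod.fst (hcl.proj a b)
    have hm : ∀ a b, (π₂ (c₂ a b)).2.1 = (a = v) := fun a b =>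
      congrArg (fun p => p.2.1) (hcl.proj a b)
    refine ⟨K₂, c₂, fun a => π₁ (π₂ a).1, hcl.coherent, fun a b => ?_, ?_, ?_, ?_⟩
    · change π₁ (π₂ (c₂ a b)).1 = c a b
      rw [hf, h2]
    · intro s hs u hu
      rcases Finset.mem_insert.1 hs with rfl | hs
      · have := hm u u
        rw [hu, hm] at this
        simpa using this.symm
      · apply h3 s hs u
        rw [← hf, hu, hf]
    · intro k γ hk hI
      rw [Finset.card_insert_of_notMem hv, show k + (S.card + 1) = (k + 1) + S.card by ring]
      apply h4 (k + 1) γ (by omega)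
      apply Identified.of_mark v
      exact hcl.identified hk hI
    · intro K'' c'' hc'' hfin hsep
      have hfin₁ := h5 K'' c'' hc'' hfin fun s hs => hsep s (Finset.mem_insert_of_mem hs)
      apply hcl.coarsest K'' c'' hc''
      intro a b a' b' hab
      simp only [mark, Prod.mk.injEq]
      refine ⟨hfin₁ _ _ _ _ hab, ?_, ?_⟩
      · have := hc''.left hab
        refine propext ⟨?_, ?_⟩
        · rintro rfl; exact hsep _ (Finset.mem_insert_self _ _) _ this.symm
        · rintro rfl; exact hsep _ (Finset.mem_insert_self _ _) _ this
      · have := hc''.right hab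
        refine propext ⟨?_, ?_⟩
        · rintro rfl; exact hsep _ (Finset.mem_insert_self _ _) _ this.symm
        · rintro rfl; exact hsep _ (Finset.mem_insert_self _ _) _ this

end

/-! ### Identification through components -/

section

/-- The structures are isomorphic up to the colors of vertices and the relation `γ`. -/
def Similar {V W : Type u} {K : Type v} (γ : K → Prop) (c : V → V → K) (d : W → W → K) : Prop :=
  ∃ φ : V ≃ W, (∀ u, d (φ u) (φ u) = c u u) ∧ ∀ u v, γ (d (φ u) (φ v)) ↔ γ (c u v)

theorem Similar.symm {V W : Type u} {K : Type v} {γ : K → Prop} {c : V → V → K} {d : W → W → K}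
    (h : Similar γ c d) : Similar γ d c := by
  obtain ⟨φ, h1, h2⟩ := h
  refine ⟨φ.symm, fun u => ?_, fun u v => ?_⟩
  · rw [← h1]; simp
  · rw [← h2]; simp

theorem Similar.trans {V W X : Type u} {K : Type v} {γ : K → Prop} {c : V → V → K}
    {d : W → W → K} {e : X → X → K} (h : Similar γ c d) (h' : Similar γ d e) : Similar γ c e := by
  obtain ⟨φ, h1, h2⟩ := h
  obtain ⟨ψ, h3, h4⟩ := h'
  exact ⟨φ.trans ψ, fun u => by simp [h3, h1], fun u v => by simp [h4, h2]⟩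

theorem card_fiber_comp {α A T : Type*} [Finite A] [Finite α] (f : α → A)
    (tA : A → T) (s : T → ℕ) (hsA : ∀ x, Nat.card {a // f a = x} = s (tA x)) (t : T) :
    Nat.card {a // tA (f a) = t} = Nat.card {x // tA x = t} * s t := by
  have e1 : {a // tA (f a) = t} ≃ Σ x : {x // tA x = t}, {a // f a = x} :=
    { toFun := fun a => ⟨⟨f a, a.2⟩, ⟨a, rfl⟩⟩
      invFun := fun p => ⟨p.2, by rw [p.2.2]; exact p.1.2⟩
      left_inv := fun a => rfl
      right_inv := by
        rintro ⟨⟨x, hx⟩, ⟨a, ha⟩⟩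
        change f a = x at ha
        subst ha
        rfl }
  have := Fintype.ofFinite {x // tA x = t}
  rw [Nat.card_congr e1, Nat.card_sigma, Finset.sum_congr rfl (fun x _ => by rw [hsA, x.2]),
    Finset.sum_const, Finset.card_univ, Nat.card_eq_fintype_card, smul_eq_mul]

/-- The points of `α` and `β` are counted by the type of their class. All classes of type `t` have
the same size `s t`, so dividing by it shows that both sides have equally many classes of each type.
-/
theorem exists_equiv_of_weighted {α β A B T : Type*} [Finite α] [Finite β] {f : α → A} {g : β → B}
    (hf : Function.Surjective f) (hg : Function.Surjective g) (tA : A → T) (tB : B → T)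
    (σ : α ≃ β) (hσ : ∀ a, tB (g (σ a)) = tA (f a)) (s : T → ℕ)
    (hsA : ∀ x, Nat.card {a // f a = x} = s (tA x))
    (hsB : ∀ y, Nat.card {b // g b = y} = s (tB y)) :
    ∃ e : A ≃ B, ∀ x, tB (e x) = tA x := by
  have : Finite A := Finite.of_surjective f hf
  have : Finite B := Finite.of_surjective g hg
  have hA := card_fiber_comp f tA s hsA
  have hB := card_fiber_comp g tB s hsB
  have key : ∀ t, Nonempty ({x // tA x = t} ≃ {y // tB y = t}) := by
    intro t
    apply Finite.card_eq.1
    have h1 : Nat.card {a // tA (f a) = t} = Nat.card {b // tB (g b) = t} :=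
      Nat.card_congr (σ.subtypeEquiv fun a => by rw [hσ])
    rw [hA, hB] at h1
    by_cases hs : s t = 0
    · have h2 : IsEmpty {x // tA x = t} := by
        refine ⟨fun ⟨x, hx⟩ => ?_⟩
        obtain ⟨a, rfl⟩ := hf x
        have : Nonempty {a' // f a' = f a} := ⟨⟨a, rfl⟩⟩
        have h3 := hsA (f a)
        rw [hx, hs] at h3
        exact Nat.card_pos.ne' h3
      have h3 : IsEmpty {x // tB x = t} := by
        refine ⟨fun ⟨x, hx⟩ => ?_⟩
        obtain ⟨a, rfl⟩ := hg x
        have : Nonempty {a' // g a' = g a} := ⟨⟨a, rfl⟩⟩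
        have h3 := hsB (g a)
        rw [hx, hs] at h3
        exact Nat.card_pos.ne' h3
      simp
    · exact Nat.eq_of_mul_eq_mul_right (Nat.pos_of_ne_zero hs) h1
  let e := fun t => (key t).some
  exact ⟨Equiv.ofFiberEquiv e, fun x => Equiv.ofFiberEquiv_map e x⟩

variable {V W : Type u} {K : Type v} {k : ℕ}

/-- Every pebble is moved onto the vertex under pebble `j`; preservation of equalities forces the
answer `y j`. -/
theorem IsBisim.const {c : V → V → K} {d : W → W → K} {R : (Fin k → V) → (Fin k → W) → Prop}
    (h : IsBisim k c d R) {x : Fin k → V} {y : Fin k → W} (hR : R x y) (j : Fin k) :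
    R (fun _ => x j) (fun _ => y j) := by
  classical
  have key : ∀ s : Finset (Fin k),
      R (fun i => if i ∈ s then x j else x i) (fun i => if i ∈ s then y j else y i) := by
    intro s
    induction s using Finset.induction_on with
    | empty => simpa using hR
    | insert a s _ ih =>
      by_cases haj : a = j
      · subst haj
        convert ih using 1
        · funext i
          by_cases hi : i = a
          · subst hi; simp
          · simp [hi]
        · funext i
          by_cases hi : i = a
          · subst hi; simp
          · simp [hi]
      · obtain ⟨σ, hσ⟩ := h.step _ _ ih
        have h1 := hσ (x j) a
        have h2 := h.eq _ _ h1 a j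
        simp only [Function.update_self, Function.update_of_ne (Ne.symm haj), ite_self,
          true_iff] at h2
        rw [h2] at h1
        convert h1 using 1
        · funext i
          by_cases hi : i = a
          · subst hi; simp
          · simp [hi]
        · funext i
          by_cases hi : i = a
          · subst hi; simp
          · simp [hi]
  simpa using key Finset.univ

/-- Any three points of `W` have a copy in `V`, so universal statements about the colors of at most
three points carry over from `c` to `d`. -/
theorem IsBisim.exists_triple {c : V → V → K} {d : W → W → K}
    {R : (Fin k → V) → (Fin k → W) → Prop} (hk : 3 ≤ k) (h : IsBisim k c d R)
    (hne : ∃ x y, R x y) (b : Fin 3 → W) :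
    ∃ a : Fin 3 → V, ∀ i j, c (a i) (a j) = d (b i) (b j) := by
  obtain ⟨y, hy⟩ := h.flip.total (by obtain ⟨x, y, h⟩ := hne; exact ⟨y, x, h⟩)
    (fun i : Fin k => b ⟨min i 2, by omega⟩)
  refine ⟨fun i => y (Fin.castLE hk i), fun i j => ?_⟩
  rw [h.color _ _ hy]
  congr 2 <;> (apply Fin.ext; simp; omega)

/-- The game can be confined to a pair of corresponding classes, so corresponding classes are
similar. One bijection of Duplicator shows that similar classes occur equally often on both sides.
The isomorphisms of classes are then glued, and `hdet` settles `γ` across classes. -/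
theorem Identified.of_components [Finite V] (hk : 3 ≤ k) {c : V → V → K} {γ : K → Prop}
    (E : K → Prop) (hE : Equivalence fun u v => E (c u v))
    (hdet : ∀ u v u' v', ¬ E (c u v) → ¬ E (c u' v') → c u u = c u' u' → c v v = c v' v' →
      (γ (c u v) ↔ γ (c u' v')))
    (hI : ∀ p, Identified k (fun u v : {v // E (c p v)} => c u v) γ) : Identified k c γ := by
  classical
  rintro W d ⟨R, hR, hne⟩
  have htri := hR.exists_triple hk hne
  have hE' : Equivalence fun a b => E (d a b) := by
    refine ⟨fun a => ?_, fun {a b} h => ?_, fun {a b e} h1 h2 => ?_⟩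
    · obtain ⟨x, hx⟩ := htri (fun _ => a)
      have := hx 0 0
      rw [← this]; exact hE.refl _
    · obtain ⟨x, hx⟩ := htri ![a, b, b]
      have h1 := hx 0 1
      have h2 := hx 1 0
      simp only [Matrix.cons_val_zero, Matrix.cons_val_one] at h1 h2
      rw [← h2]; rw [← h1] at h; exact hE.symm h
    · obtain ⟨x, hx⟩ := htri ![a, b, e]
      have h3 := hx 0 1
      have h4 := hx 1 2
      have h5 := hx 0 2
      simp only [Matrix.cons_val_zero, Matrix.cons_val_one, Matrix.cons_val] at h3 h4 h5
      rw [← h3] at h1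
      rw [← h4] at h2
      rw [← h5]
      exact hE.trans h1 h2
  let i0 : Fin k := ⟨0, by omega⟩
  let i1 : Fin k := ⟨1, by omega⟩
  have h01 : i0 ≠ i1 := by simp [i0, i1]
  have hclass : ∀ p q, R (fun _ => p) (fun _ => q) →
      Similar γ (fun u v : {v // E (c p v)} => c u v) (fun a b : {b // E (d q b)} => d a b) := by
    intro p q hpq
    refine hI p _ (fun a b : {b // E (d q b)} => d a b) ?_
    refine ⟨fun x y => R (fun i => x i) (fun i => y i), ⟨?_, ?_, ?_⟩,
      fun _ => ⟨p, hE.refl p⟩, fun _ => ⟨q, hE'.refl q⟩, hpq⟩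
    · intro x y hxy i j
      exact hR.color _ _ hxy i j
    · intro x y hxy i j
      rw [Subtype.ext_iff, Subtype.ext_iff]
      exact hR.eq _ _ hxy i j
    · intro x y hxy
      obtain ⟨σ, hσ⟩ := hR.step _ _ hxy
      -- If pebble 1 goes to `w`, pebble 0 still lies in the class of `p`, so the color of this pair
      -- tells whether `w` lies there too.
      have hmem : ∀ w, E (c p w) ↔ E (d q (σ w)) := by
        intro w
        have h1 := hR.color _ _ (hσ w i1) i0 i1
        simp only [Function.update_self, Function.update_of_ne h01] at h1
        constructor
        · intro h2
          refine hE'.trans (y i0).2 ?_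
          rw [← h1]
          exact hE.trans (hE.symm (x i0).2) h2
        · intro h2
          refine hE.trans (x i0).2 ?_
          rw [h1]
          exact hE'.trans (hE'.symm (y i0).2) h2
      refine ⟨σ.subtypeEquiv hmem, fun w i => ?_⟩
      convert hσ w i using 1
      · funext j
        by_cases hj : j = i
        · subst hj; simp
        · simp [hj]
      · funext j
        by_cases hj : j = i
        · subst hj; simp
        · simp [hj]
  obtain ⟨x₀, y₀, hxy₀⟩ := hne
  obtain ⟨σ, hσ⟩ := hR.step _ _ hxy₀
  have hlink : ∀ p, R (fun _ => p) (fun _ => σ p) := by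
    intro p
    simpa using hR.const (hσ p i0) i0
  have : Finite W := Finite.of_equiv V σ
  let sV : Setoid V := ⟨_, hE⟩
  let sW : Setoid W := ⟨_, hE'⟩
  have hclassV : ∀ p p', E (c p p') → (fun v => E (c p v)) = fun v => E (c p' v) := by
    intro p p' h
    funext v
    exact propext ⟨fun h' => hE.trans (hE.symm h) h', fun h' => hE.trans h h'⟩
  have hclassW : ∀ p p', E (d p p') → (fun v => E (d p v)) = fun v => E (d p' v) := by
    intro p p' h
    funext v
    exact propext ⟨fun h' => hE'.trans (hE'.symm h) h', fun h' => hE'.trans h h'⟩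
  have simV : ∀ p p', E (c p p') → Similar γ (fun u v : {v // E (c p v)} => c u v)
      (fun u v : {v // E (c p' v)} => c u v) := by
    intro p p' h
    refine ⟨Equiv.subtypeEquivRight fun v => iff_of_eq (congrFun (hclassV p p' h) v),
      fun u => rfl, fun u v => Iff.rfl⟩
  have simW : ∀ p p', E (d p p') → Similar γ (fun u v : {v // E (d p v)} => d u v)
      (fun u v : {v // E (d p' v)} => d u v) := by
    intro p p' h
    refine ⟨Equiv.subtypeEquivRight fun v => iff_of_eq (congrFun (hclassW p p' h) v),
      fun u => rfl, fun u v => Iff.rfl⟩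
  -- Types of classes are similarity types of classes of `V`; a class of `W` gets its type by
  -- pulling a representative back along `σ`.
  let sT : Setoid V :=
    ⟨fun p p' => Similar γ (fun u v : {v // E (c p v)} => c u v)
      (fun u v : {v // E (c p' v)} => c u v),
      ⟨fun p => simV p p (hE.refl p), fun h => h.symm, fun h h' => h.trans h'⟩⟩
  let tV : Quotient sV → Quotient sT :=
    Quotient.lift (fun p => (Quotient.mk sT p)) fun p p' h => Quotient.sound (simV p p' h)
  let tW : Quotient sW → Quotient sT :=
    Quotient.lift (fun q => (Quotient.mk sT (σ.symm q))) fun q q' h => Quotient.sound <| by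
      have h1 := hclass _ _ (hlink (σ.symm q))
      have h2 := hclass _ _ (hlink (σ.symm q'))
      rw [Equiv.apply_symm_apply] at h1 h2
      exact (h1.trans (simW q q' h)).trans h2.symm
  let s : Quotient sT → ℕ := Quotient.lift (fun p => Nat.card {v // E (c p v)})
    fun p p' ⟨φ, _⟩ => Nat.card_congr φ
  obtain ⟨e, he⟩ := exists_equiv_of_weighted (f := Quotient.mk sV) (g := Quotient.mk sW)
    Quotient.mk_surjective Quotient.mk_surjective tV tW σ
    (fun a => by simp [tV, tW]) s
    (fun P => by
      obtain ⟨p, rfl⟩ := Quotient.mk_surjective P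
      refine Nat.card_congr (Equiv.subtypeEquivRight fun v => ?_)
      rw [Quotient.eq]
      exact ⟨fun h => hE.symm h, fun h => hE.symm h⟩)
    (fun Q => by
      obtain ⟨q, rfl⟩ := Quotient.mk_surjective Q
      have h1 := hclass _ _ (hlink (σ.symm q))
      rw [Equiv.apply_symm_apply] at h1
      obtain ⟨φ, _⟩ := h1
      refine (Nat.card_congr (Equiv.subtypeEquivRight fun v => ?_)).trans (Nat.card_congr φ).symm
      rw [Quotient.eq]
      exact ⟨fun h => hE'.symm h, fun h => hE'.symm h⟩)
  have hpiece : ∀ P : Quotient sV, ∃ φ : {v // Quotient.mk sV v = P} ≃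
      {b // e.symm (Quotient.mk sW b) = P},
      (∀ u, d (φ u) (φ u) = c u u) ∧ ∀ u v, γ (d (φ u) (φ v)) ↔ γ (c u v) := by
    intro P
    obtain ⟨p, rfl⟩ := Quotient.mk_surjective P
    obtain ⟨q, hq⟩ := Quotient.mk_surjective (e (Quotient.mk sV p))
    have h1 := hclass _ _ (hlink (σ.symm q))
    rw [Equiv.apply_symm_apply] at h1
    have h2 : tW (Quotient.mk sW q) = tV (Quotient.mk sV p) := by rw [hq, he]
    have h3 : Similar γ (fun u v : {v // E (c (σ.symm q) v)} => c u v)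
      (fun u v : {v // E (c p v)} => c u v) := Quotient.exact h2
    obtain ⟨φ, h4, h5⟩ := h3.symm.trans h1
    let e1 : {v // Quotient.mk sV v = Quotient.mk sV p} ≃ {v // E (c p v)} :=
      Equiv.subtypeEquivRight fun v => by
        rw [Quotient.eq]; exact ⟨fun h => hE.symm h, fun h => hE.symm h⟩
    let e2 : {b // E (d q b)} ≃ {b // e.symm (Quotient.mk sW b) = Quotient.mk sV p} :=
      Equiv.subtypeEquivRight fun b => by
        rw [Equiv.symm_apply_eq, ← hq, Quotient.eq]
        exact ⟨fun h => hE'.symm h, fun h => hE'.symm h⟩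
    exact ⟨(e1.trans φ).trans e2, fun u => h4 (e1 u), fun u v => h5 (e1 u) (e1 v)⟩
  choose ε hε1 hε2 using hpiece
  let φ : V ≃ W := Equiv.ofFiberEquiv ε
  have hφ : ∀ v P (h : Quotient.mk sV v = P), φ v = ε P ⟨v, h⟩ := by
    rintro v P rfl
    rfl
  have hdiag : ∀ u, d (φ u) (φ u) = c u u := fun u => by
    rw [hφ u _ rfl]; exact hε1 _ _
  refine ⟨φ, hdiag, fun u v => ?_⟩
  by_cases huv : E (c u v)
  · have hP : Quotient.mk sV u = Quotient.mk sV v := Quotient.sound huv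
    rw [hφ u _ hP, hφ v _ rfl]
    exact hε2 _ _ _
  · have hmk : ∀ w, Quotient.mk sW (φ w) = e (Quotient.mk sV w) := fun w => by
      rw [← Equiv.symm_apply_eq]; exact Equiv.ofFiberEquiv_map ε w
    have h1 : ¬ E (d (φ u) (φ v)) := by
      intro h
      have h2 : Quotient.mk sW (φ u) = Quotient.mk sW (φ v) := Quotient.sound h
      rw [hmk, hmk] at h2
      exact huv (Quotient.exact (e.injective h2))
    -- The hypothesis `hdet` speaks of `V` only, so the pair in `W` is replaced by a copy in `V`.
    obtain ⟨x, hx⟩ := htri ![φ u, φ v, φ v]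
    have h3 := hx 0 1
    have h4 := hx 0 0
    have h5 := hx 1 1
    simp only [Matrix.cons_val_zero, Matrix.cons_val_one, hdiag] at h3 h4 h5
    rw [← h3] at h1 ⊢
    exact hdet _ _ _ _ h1 huv h4 h5

/-- There are enough pebbles to cover all of `V` at once, and such a position is an isomorphism. -/
theorem Identified.of_card_le [Finite V] [Nonempty V] {c : V → V → K} {γ : K → Prop}
    (hk : Nat.card V ≤ k) : Identified k c γ := by
  rintro W d ⟨R, hR, hne⟩
  have := Fintype.ofFinite V
  rw [Nat.card_eq_fintype_card] at hk
  have hpos : 0 < Fintype.card V := Fintype.card_pos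
  obtain ⟨f, hf⟩ : ∃ f : Fin k → V, Function.Surjective f :=
    ⟨fun i => if h : i.1 < Fintype.card V then (Fintype.equivFin V).symm ⟨i, h⟩
      else Classical.arbitrary V, fun v => by
        refine ⟨⟨Fintype.equivFin V v, lt_of_lt_of_le (Fin.is_lt _) hk⟩, ?_⟩
        simp⟩
  obtain ⟨y, hy⟩ := hR.total hne f
  obtain ⟨σ, -⟩ := hR.step _ _ hy
  have : Finite W := Finite.of_equiv V σ
  choose g hg using hf
  have hinj : Function.Injective fun v => y (g v) := by
    intro a b hab
    have := (hR.eq _ _ hy (g a) (g b)).2 hab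
    rwa [hg, hg] at this
  let φ : V ≃ W := Equiv.ofBijective _
    ((Nat.bijective_iff_injective_and_card _).2 ⟨hinj, Nat.card_congr σ⟩)
  have hc : ∀ u v, d (φ u) (φ v) = c u v := fun u v => by
    have := hR.color _ _ hy (g u) (g v)
    rw [hg, hg] at this
    exact this.symm
  exact ⟨φ, fun u => hc u u, fun u v => by rw [hc]⟩

end

/-! ### Counting fibers, and Fisher's inequality -/

section

variable {V : Type u} {K K' : Type v}

/-- The number of fibers, that is, of colors of vertices. -/
noncomputable def numFibers (c : V → V → K) : ℕ := (Set.range fun u => c u u).ncard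

theorem exists_transversal [Finite V] (c : V → V → K) :
    ∃ A : Finset V, Set.InjOn (fun u => c u u) A ∧ A.card = numFibers c ∧
      ∀ v, ∃ a ∈ A, c a a = c v v := by
  classical
  have := Fintype.ofFinite V
  choose g hg using fun κ : Set.range fun u => c u u => κ.2
  have hginj : Function.Injective g := fun a b hab => by
    apply Subtype.ext
    rw [← hg a, ← hg b, hab]
  have := Fintype.ofFinite (Set.range fun u => c u u)
  refine ⟨Finset.univ.image g, ?_, ?_, fun v => ?_⟩
  · intro a ha b hb hab
    simp only [Finset.coe_image, Finset.coe_univ, Set.image_univ, Set.mem_range] at ha hb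
    obtain ⟨κ, rfl⟩ := ha
    obtain ⟨κ', rfl⟩ := hb
    congr 1
    apply Subtype.ext
    rw [← hg κ, ← hg κ']
    exact hab
  · rw [Finset.card_image_of_injective _ hginj, Finset.card_univ, numFibers,
      ← Nat.card_coe_set_eq, Nat.card_eq_fintype_card]
  · exact ⟨g ⟨c v v, v, rfl⟩, Finset.mem_image_of_mem _ (Finset.mem_univ _), hg ⟨c v v, v, rfl⟩⟩

theorem card_le_numFibers [Finite V] {c : V → V → K} {A : Finset V}
    (hA : Set.InjOn (fun u => c u u) A) : A.card ≤ numFibers c := by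
  rw [← Set.ncard_coe_finset, ← hA.ncard_image]
  exact Set.ncard_le_ncard (Set.image_subset_range _ _) (Set.finite_range _)

/-- Fibers of `c` that `A` misses contribute at least one fiber of `c'` each; those it meets
contribute at least the points of `A` in them. -/
theorem numFibers_add_card_le [Finite V] [DecidableEq K] {c : V → V → K} {c' : V → V → K'}
    (hf : Finer c' c) {A : Finset V} (hA : Set.InjOn (fun u => c' u u) A) :
    numFibers c + A.card ≤ numFibers c' + (A.image fun u => c u u).card := by
  classical
  obtain ⟨B, hB, hBc, -⟩ := exists_transversal c
  let B' := B.filter fun b => c b b ∉ A.image fun u => c u u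
  have h1 : B.card ≤ B'.card + (A.image fun u => c u u).card := by
    rw [← Finset.card_filter_add_card_filter_not (s := B)
      (fun b => c b b ∉ A.image fun u => c u u)]
    apply Nat.add_le_add_left
    apply Finset.card_le_card_of_injOn (fun u => c u u)
    · intro b hb
      simpa using (Finset.mem_filter.1 hb).2
    · intro a ha b hb hab
      exact hB (Finset.mem_filter.1 ha).1 (Finset.mem_filter.1 hb).1 hab
  have hAB : ∀ a ∈ A, ∀ b ∈ B', c' a a ≠ c' b b := by
    intro a ha b hb h
    apply (Finset.mem_filter.1 hb).2
    rw [← hf _ _ _ _ h]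
    exact Finset.mem_image_of_mem _ ha
  have hdisj : Disjoint A B' := Finset.disjoint_left.2 fun a ha hb => hAB a ha a hb rfl
  have h2 : (A ∪ B').card ≤ numFibers c' := by
    apply card_le_numFibers
    intro a ha b hb hab
    simp only [Finset.coe_union, Set.mem_union, Finset.mem_coe] at ha hb
    rcases ha with ha | ha <;> rcases hb with hb | hb
    · exact hA ha hb hab
    · exact (hAB a ha b hb hab).elim
    · exact (hAB b hb a ha hab.symm).elim
    · exact hB (Finset.mem_filter.1 ha).1 (Finset.mem_filter.1 hb).1 (hf _ _ _ _ hab)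
  rw [Finset.card_union_of_disjoint hdisj] at h2
  omega

theorem numFibers_add_sum_le [Finite V] {ι : Type*} [Fintype ι] {c : V → V → K}
    {c' : V → V → K'} (hf : Finer c' c) (p : ι → V)
    (hp : Function.Injective fun i => c (p i) (p i)) (A : ι → Finset V)
    (hAp : ∀ i, ∀ a ∈ A i, c a a = c (p i) (p i))
    (hA : ∀ i, Set.InjOn (fun u => c' u u) (A i)) :
    numFibers c + ∑ i, (A i).card ≤ numFibers c' + Fintype.card ι := by
  classical
  have h1 := numFibers_add_card_le hf (A := Finset.univ.biUnion A) (by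
    intro a ha b hb hab
    simp only [Finset.coe_biUnion, Finset.coe_univ, Set.mem_univ, Set.iUnion_true,
      Set.mem_iUnion, Finset.mem_coe] at ha hb
    obtain ⟨i, hi⟩ := ha
    obtain ⟨j, hj⟩ := hb
    have hij : i = j := by
      apply hp
      have := hf _ _ _ _ hab
      rw [hAp i a hi, hAp j b hj] at this
      exact this
    subst hij
    exact hA i hi hj hab)
  rw [Finset.card_biUnion] at h1
  · have h2 : ((Finset.univ.biUnion A).image fun u => c u u).card ≤ Fintype.card ι := by
      rw [← Finset.card_univ, ← Finset.card_image_of_injective _ hp]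
      apply Finset.card_le_card
      intro κ hκ
      simp only [Finset.mem_image, Finset.mem_biUnion, Finset.mem_univ, true_and] at hκ ⊢
      obtain ⟨a, ⟨i, hi⟩, rfl⟩ := hκ
      exact ⟨i, (hAp i a hi).symm⟩
    omega
  · intro i _ j _ hij
    refine Finset.disjoint_left.2 fun a hi hj => hij (hp ?_)
    change c (p i) (p i) = c (p j) (p j)
    rw [← hAp i a hi, ← hAp j a hj]

/-- A singleton fiber is fixed by every matching that coherence provides, so individualizing `s`
splits other fibers according to their colors towards `s`. -/
theorem Coherent.eq_of_separates {c : V → V → K} (hc : Coherent c) {S : Finset V}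
    (hS : Separates c S) {s u v : V} (hs : s ∈ S) (h : c u u = c v v) : c u s = c v s := by
  obtain ⟨σ, hσ⟩ := hc.perm _ _ _ _ h
  have h1 := (hσ s).1
  have h2 := hS s hs (σ s) (hc.right h1).symm
  rw [h1, h2]

theorem Coherent.eq_of_separates' {c : V → V → K} {c' : V → V → K'} (hc : Coherent c)
    (hc' : Coherent c') (hf : Finer c' c) {S : Finset V}
    (hS : Separates c' S) {s u v : V} (hs : s ∈ S) (h : c' u u = c' v v) :
    c s u = c s v :=
  hc.symm _ _ _ _ (hf _ _ _ _ (hc'.eq_of_separates hS hs h))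

/-- The fibers of `u` and `v` are joined by at least two basis relations. -/
def Linked (c : V → V → K) (u v : V) : Prop := ∃ w, c w w = c v v ∧ c u w ≠ c u v

theorem Linked.congr_right {c : V → V → K} {u v v' : V} (h : Linked c u v)
    (hv : c v v = c v' v') : Linked c u v' := by
  obtain ⟨w, h1, h2⟩ := h
  by_cases h3 : c u v = c u v'
  · exact ⟨w, h1.trans hv, by rwa [← h3]⟩
  · exact ⟨v, hv, h3⟩

theorem Linked.congr_left {c : V → V → K} (hc : Coherent c) {u u' v : V} (h : Linked c u v)
    (hu : c u u = c u' u') : Linked c u' v := by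
  obtain ⟨w, h1, h2⟩ := h
  obtain ⟨σ, hσ⟩ := hc.perm _ _ _ _ hu
  have h3 := hc.right (hσ v).1
  have h4 := hc.right (hσ w).1
  have : Linked c u' (σ v) :=
    ⟨σ w, by rw [← h3, ← h4, h1], by rw [← (hσ w).1, ← (hσ v).1]; exact h2⟩
  exact this.congr_right h3.symm

theorem Linked.symm {c : V → V → K} (hc : Coherent c) {u v : V} (h : Linked c u v) :
    Linked c v u := by
  obtain ⟨w, h1, h2⟩ := h
  obtain ⟨σ, hσ⟩ := hc.perm _ _ _ _ h1
  have h3 := (hσ u).2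
  refine ⟨σ u, (hc.left h3).symm, fun h4 => h2 ?_⟩
  rw [h3]
  exact hc.symm _ _ _ _ h4

theorem Linked.exists_ne {c : V → V → K} (hc : Coherent c) {u v : V} (h : Linked c u v) :
    ∃ w, c w w = c u u ∧ w ≠ u := by
  obtain ⟨w, h1, h2⟩ := h.symm hc
  exact ⟨w, h1, fun h => h2 (by rw [h])⟩

theorem Coherent.eq_of_not_linked {c : V → V → K} (hc : Coherent c) {u v u' v' : V}
    (h : ¬ Linked c u v) (hu : c u u = c u' u') (hv : c v v = c v' v') : c u v = c u' v' := by
  obtain ⟨σ, hσ⟩ := hc.perm _ _ _ _ hu.symm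
  have h1 := hc.right (hσ v').1
  rw [(hσ v').1]
  by_contra h2
  exact h ⟨σ v', by rw [← h1, hv], fun h => h2 h.symm⟩

/-- Every sequence of individualizations creates less than four times as many fibers. -/
def Stuck (c : V → V → K) : Prop :=
  ∀ S : Finset V, S.Nonempty → ∃ (K' : Type v) (c' : V → V → K'), Coherent c' ∧ Finer c' c ∧
    Separates c' S ∧ numFibers c' < numFibers c + 4 * S.card

/-- Fisher's inequality: a fiber on which all pairs of distinct points have the same color has at
most as many points as there are neighborhoods of points of another fiber in it. -/
theorem Coherent.fisher [Fintype V] [DecidableEq K] {c : V → V → K} (hc : Coherent c) {x₀ y₀ : V}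
    (hrank : ∀ x x' z z', c x x = c x₀ x₀ → c x' x' = c x₀ x₀ → c z z = c x₀ x₀ →
      c z' z' = c x₀ x₀ → x ≠ x' → z ≠ z' → c x x' = c z z')
    (hl : Linked c x₀ y₀) :
    ∃ A : Finset V, A.card = (Finset.univ.filter fun x => c x x = c x₀ x₀).card ∧
      (∀ a ∈ A, c a a = c y₀ y₀) ∧
      ∀ a ∈ A, ∀ b ∈ A, (∀ x, c x x = c x₀ x₀ → c x a = c x b) → a = b := by
  classical
  obtain ⟨y₁, hy, hne⟩ := hl
  set a := c x₀ y₀ with ha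
  let X := {x // c x x = c x₀ x₀}
  let Y := Finset.univ.filter fun y => c y y = c y₀ y₀
  let tr : V → X → K := fun y x => c x y
  let N : V → V → ℕ := fun x x' => (Finset.univ.filter fun y => c x y = a ∧ c x' y = a).card
  have hN : ∀ x x' z z', c x x' = c z z' → N x x' = N z z' := by
    intro x x' z z' h
    obtain ⟨σ, hσ⟩ := hc.perm _ _ _ _ h
    refine Finset.card_equiv σ fun y => ?_
    simp only [Finset.mem_filter, Finset.mem_univ, true_and]
    rw [← (hσ y).1, hc.symm _ _ _ _ (hσ y).2]
  obtain ⟨σ, hσ⟩ := hc.perm _ _ _ _ hy.symm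
  have hx₁a : a = c (σ x₀) y₁ := (hσ x₀).2
  have hx₁ : c (σ x₀) (σ x₀) = c x₀ x₀ := (hc.left hx₁a).symm
  have hx₁ne : σ x₀ ≠ x₀ := fun h => hne (by rw [h] at hx₁a; exact hx₁a.symm)
  -- In design language, λ < r: the point `y₁` is an `a`-neighbor of `σ x₀` but not of `x₀`.
  have hlt : N x₀ (σ x₀) < N x₀ x₀ := by
    rw [hN x₀ x₀ _ _ hx₁.symm]
    apply Finset.card_lt_card
    refine ⟨fun y hy => ?_, fun hsub => ?_⟩
    · simp only [Finset.mem_filter, Finset.mem_univ, true_and] at hy ⊢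
      exact ⟨hy.2, hy.2⟩
    · have : y₁ ∈ Finset.univ.filter fun y => c x₀ y = a ∧ c (σ x₀) y = a :=
        hsub (by simp [← hx₁a])
      simp only [Finset.mem_filter, Finset.mem_univ, true_and] at this
      exact hne this.1
  let Q := Y.image tr
  -- The rows of the incidence matrix are independent, since its Gram matrix (r − λ)I + λJ is
  -- positive definite. Columns with equal traces on `X` are counted once, so the bound is for
  -- distinct traces.
  have hcard : Fintype.card X ≤ Q.card := by
    let f : X → Q → ℝ := fun x q => if q.1 x = a then 1 else 0
    have hf : LinearIndependent ℝ f := by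
      rw [Fintype.linearIndependent_iff]
      intro g hg
      have h0 : ∀ y : V, ∑ x : X, g x * (if c x y = a then (1 : ℝ) else 0) = 0 := by
        intro y
        by_cases hyY : c y y = c y₀ y₀
        · have := congrFun hg ⟨tr y, Finset.mem_image_of_mem _ (by simp [Y, hyY])⟩
          simpa [f, tr] using this
        · apply Finset.sum_eq_zero
          intro x _
          rw [if_neg, mul_zero]
          intro h
          exact hyY (hc.right h)
      have h1 : ∑ y : V, (∑ x : X, g x * (if c x y = a then (1 : ℝ) else 0)) ^ 2 = 0 :=
        Finset.sum_eq_zero fun y _ => by rw [h0, zero_pow two_ne_zero]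
      have h2 : ∑ y : V, (∑ x : X, g x * (if c x y = a then (1 : ℝ) else 0)) ^ 2 =
          ∑ x : X, ∑ x' : X, g x * g x' * N x x' := by
        simp only [sq, Finset.sum_mul_sum]
        rw [Finset.sum_comm]
        refine Finset.sum_congr rfl fun x _ => ?_
        rw [Finset.sum_comm]
        refine Finset.sum_congr rfl fun x' _ => ?_
        simp only [N, Finset.card_filter, Nat.cast_sum, Finset.mul_sum]
        refine Finset.sum_congr rfl fun y _ => ?_
        by_cases h3 : c x y = a <;> by_cases h4 : c x' y = a <;> simp [h3, h4]
      have h3 : ∀ x x' : X, (N x x' : ℝ) =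
          (if x = x' then ((N x₀ x₀ : ℝ) - N x₀ (σ x₀)) else 0) + N x₀ (σ x₀) := by
        intro x x'
        by_cases h : x = x'
        · subst h
          rw [if_pos rfl, hN _ _ _ _ x.2]; ring
        · rw [if_neg h, hN _ _ x₀ (σ x₀)]
          · ring
          · exact hrank _ _ _ _ x.2 x'.2 rfl hx₁ (fun h' => h (Subtype.ext h')) hx₁ne.symm
      have h4 : ∑ x : X, ∑ x' : X, g x * g x' * N x x' =
          ((N x₀ x₀ : ℝ) - N x₀ (σ x₀)) * ∑ x : X, g x ^ 2 +
            N x₀ (σ x₀) * (∑ x : X, g x) ^ 2 := by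
        simp only [h3, mul_add, Finset.sum_add_distrib, mul_ite, mul_zero]
        rw [sq, Finset.sum_mul_sum, Finset.mul_sum, Finset.mul_sum]
        congr 1
        · refine Finset.sum_congr rfl fun x _ => ?_
          rw [Finset.sum_eq_single x (fun b _ hb => if_neg hb.symm) (by simp), if_pos rfl]
          ring
        · refine Finset.sum_congr rfl fun x _ => ?_
          rw [Finset.mul_sum]
          exact Finset.sum_congr rfl fun x' _ => by ring
      rw [h2, h4] at h1
      have hpos : (0 : ℝ) < (N x₀ x₀ : ℝ) - N x₀ (σ x₀) := by
        have : (N x₀ (σ x₀) : ℝ) < N x₀ x₀ := by exact_mod_cast hlt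
        linarith
      have h5 : (0 : ℝ) ≤ N x₀ (σ x₀) * (∑ x : X, g x) ^ 2 := by positivity
      have h6 : (0 : ℝ) ≤ ∑ x : X, g x ^ 2 := Finset.sum_nonneg fun x _ => sq_nonneg _
      have h7 : ∑ x : X, g x ^ 2 = 0 := by
        by_contra h
        have := mul_pos hpos (lt_of_le_of_ne h6 (Ne.symm h))
        linarith
      rw [Finset.sum_eq_zero_iff_of_nonneg fun x _ => sq_nonneg _] at h7
      intro x
      exact pow_eq_zero_iff (two_ne_zero) |>.1 (h7 x (Finset.mem_univ x))
    have := hf.fintype_card_le_finrank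
    rwa [Module.finrank_fintype_fun_eq_card, Fintype.card_coe] at this
  choose g hgY hg using fun q : Q => Finset.mem_image.1 q.2
  have hginj : Function.Injective g := fun q q' h => by
    apply Subtype.ext
    rw [← hg q, ← hg q', h]
  obtain ⟨A, hAsub, hAcard⟩ := Finset.exists_subset_card_eq
    (s := Finset.univ.image g) (n := Fintype.card X)
    (by rw [Finset.card_image_of_injective _ hginj, Finset.card_univ, Fintype.card_coe]
        exact hcard)
  refine ⟨A, by rw [hAcard, Fintype.card_subtype], fun b hb => ?_, fun b hb b' hb' h => ?_⟩
  · obtain ⟨q, -, rfl⟩ := Finset.mem_image.1 (hAsub hb)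
    exact (Finset.mem_filter.1 (hgY q)).2
  · obtain ⟨q, -, rfl⟩ := Finset.mem_image.1 (hAsub hb)
    obtain ⟨q', -, rfl⟩ := Finset.mem_image.1 (hAsub hb')
    congr 1
    apply Subtype.ext
    rw [← hg q, ← hg q']
    funext x
    exact h x x.2

end

/-! ### Stuck configurations have small components of fibers -/

section

variable {V : Type u} {K K' : Type v}

theorem Finer.injOn_of_separates {c : V → V → K} {c' : V → V → K'} (hc : Coherent c)
    (hc' : Coherent c') (hf : Finer c' c) {S : Finset V} (hS : Separates c' S) {A : Finset V}
    (hA : ∀ a ∈ A, ∀ b ∈ A, (∀ x ∈ S, c x a = c x b) → a = b) :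
    Set.InjOn (fun u => c' u u) A := fun a ha b hb hab =>
  hA a ha b hb fun _ hx => hc.eq_of_separates' hc' hf hS hx hab

/-- Individualizing `u` splits its own fiber and the three linked ones, which gives four new fibers
for one vertex. -/
theorem Stuck.no_star [Finite V] {c : V → V → K} (hs : Stuck c) (hc : Coherent c) {u : V}
    {v : Fin 3 → V} (hv : Function.Injective fun i => c (v i) (v i))
    (huv : ∀ i, c u u ≠ c (v i) (v i)) (hl : ∀ i, Linked c u (v i)) : False := by
  classical
  obtain ⟨K', c', hc', hf, hsep, hlt⟩ := hs {u} (Finset.singleton_nonempty u)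
  obtain ⟨u', hu', hne⟩ := (hl 0).exists_ne hc
  choose w hw hwne using hl
  have := numFibers_add_sum_le hf (Fin.cons u v : Fin 4 → V)
    (by
      intro i j
      cases i using Fin.cases <;> cases j using Fin.cases
      · simp
      · intro h; exact (huv _ h).elim
      · intro h; exact (huv _ h.symm).elim
      · intro h; exact congrArg _ (hv h))
    (Fin.cons {u, u'} fun i => {v i, w i} : Fin 4 → Finset V)
    (by
      intro i
      cases i using Fin.cases <;> simp [hu', hw])
    (by
      intro i
      cases i using Fin.cases with
      | zero =>
        intro a ha b hb hab
        simp only [Fin.cons_zero, Finset.coe_insert, Finset.coe_singleton, Set.mem_insert_iff,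
          Set.mem_singleton_iff] at ha hb
        have h1 := hsep u (Finset.mem_singleton_self u)
        rcases ha with rfl | rfl <;> rcases hb with rfl | rfl
        · rfl
        · exact (h1 _ hab.symm).symm
        · exact h1 _ hab
        · rfl
      | succ i =>
        apply hf.injOn_of_separates hc hc' hsep
        intro a ha b hb h
        have h1 := h u (Finset.mem_singleton_self u)
        simp only [Fin.cons_succ, Finset.mem_insert, Finset.mem_singleton] at ha hb
        rcases ha with rfl | rfl <;> rcases hb with rfl | rfl
        · rfl
        · exact (hwne i h1.symm).elim
        · exact (hwne i h1).elim
        · rfl)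
  simp only [Fin.sum_univ_succ, Fin.cons_zero, Fin.cons_succ] at this
  rw [Finset.card_pair hne.symm] at this
  have h2 : ∀ i, ({v i, w i} : Finset V).card = 2 := fun i =>
    Finset.card_pair fun h => hwne i (by rw [← h])
  simp only [h2, Fintype.card_fin, Finset.card_singleton] at this hlt
  simp at this
  omega

/-- Otherwise individualizing `u` splits its fiber into at least three parts and each of the two
linked fibers into at least two, again a gain of four. -/
theorem Stuck.rank_two [Finite V] {c : V → V → K} (hs : Stuck c) (hc : Coherent c) {u v w : V}
    (huv : c u u ≠ c v v) (huw : c u u ≠ c w w) (hvw : c v v ≠ c w w)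
    (hlv : Linked c u v) (hlw : Linked c u w) :
    ∀ x x' z z', c x x = c u u → c x' x' = c u u → c z z = c u u →
      c z' z' = c u u → x ≠ x' → z ≠ z' → c x x' = c z z' := by
  classical
  have key : ∀ x x', c x x = c u u → c x' x' = c u u → x ≠ u → x' ≠ u → c u x = c u x' := by
    intro x x' hx hx' hxu hxu'
    by_contra hxx'
    obtain ⟨K', c', hc', hf, hsep, hlt⟩ := hs {u} (Finset.singleton_nonempty u)
    obtain ⟨v', hv', hvne⟩ := hlv
    obtain ⟨w', hw', hwne⟩ := hlw
    have h1 := hsep u (Finset.mem_singleton_self u)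
    have hu : ∀ a b, c' a a = c' b b → c u a = c u b := fun a b h =>
      hc.eq_of_separates' hc' hf hsep (Finset.mem_singleton_self u) h
    have := numFibers_add_sum_le hf ![u, v, w]
      (by
        intro i j
        fin_cases i <;> fin_cases j <;>
          simp [huv, huw, hvw, Ne.symm huv, Ne.symm huw, Ne.symm hvw])
      ![{u, x, x'}, {v, v'}, {w, w'}]
      (by
        intro i
        fin_cases i <;> simp [hx, hx', hv', hw'])
      (by
        intro i
        fin_cases i
        · intro a ha b hb hab
          simp only [Fin.zero_eta, Matrix.cons_val_zero, Finset.coe_insert,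
            Finset.coe_singleton, Set.mem_insert_iff, Set.mem_singleton_iff] at ha hb
          change c' a a = c' b b at hab
          have h2 := hu a b hab
          rcases ha with rfl | rfl | rfl <;> rcases hb with rfl | rfl | rfl
          · rfl
          · exact (h1 _ hab.symm).symm
          · exact (h1 _ hab.symm).symm
          · exact h1 _ hab
          · rfl
          · exact (hxx' h2).elim
          · exact h1 _ hab
          · exact (hxx' h2.symm).elim
          · rfl
        · intro a ha b hb hab
          simp only [Fin.mk_one, Matrix.cons_val_one, Matrix.cons_val_zero, Finset.coe_insert,
            Finset.coe_singleton, Set.mem_insert_iff, Set.mem_singleton_iff] at ha hb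
          have h2 := hu a b hab
          rcases ha with rfl | rfl <;> rcases hb with rfl | rfl
          · rfl
          · exact (hvne h2.symm).elim
          · exact (hvne h2).elim
          · rfl
        · intro a ha b hb hab
          simp only [Fin.reduceFinMk, Matrix.cons_val, Finset.coe_insert,
            Finset.coe_singleton, Set.mem_insert_iff, Set.mem_singleton_iff] at ha hb
          have h2 := hu a b hab
          rcases ha with rfl | rfl <;> rcases hb with rfl | rfl
          · rfl
          · exact (hwne h2.symm).elim
          · exact (hwne h2).elim
          · rfl)
    have e1 : ({u, x, x'} : Finset V).card = 3 :=
      Finset.card_eq_three.2 ⟨u, x, x', hxu.symm, hxu'.symm, fun h => hxx' (by rw [h]), rfl⟩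
    have e2 : ({v, v'} : Finset V).card = 2 := Finset.card_pair fun h => hvne (by rw [h])
    have e3 : ({w, w'} : Finset V).card = 2 := Finset.card_pair fun h => hwne (by rw [h])
    simp [Fin.sum_univ_succ, e1, e2, e3] at this
    simp at hlt
    omega
  intro x x' z z' hx hx' hz hz' hxx hzz
  obtain ⟨σ, hσ⟩ := hc.perm _ _ _ _ hx
  obtain ⟨τ, hτ⟩ := hc.perm _ _ _ _ hz
  have hne : ∀ {y y' : V} {ρ : V ≃ V}, (∀ t, c y t = c u (ρ t) ∧ c t y = c (ρ t) u) → y ≠ y' →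
      ρ y' ≠ u := by
    intro y y' ρ hρ hyy h
    have := (hρ y').1
    rw [h] at this
    have h2 := hc.diag _ _ _ this
    exact hyy h2
  rw [(hσ x').1, (hτ z').1]
  refine key _ _ ?_ ?_ (hne hσ hxx) (hne hτ hzz)
  · rw [← hc.right (hσ x').1, hx']
  · rw [← hc.right (hτ z').1, hz']

/-- By `Stuck.rank_two` and Fisher's inequality in both directions, the two middle fibers have the
same size m. Individualizing m − 1 points of the first makes both discrete, and by Fisher's
inequality again each end fiber splits into at least m parts. The gain is at least 4m − 4. -/
theorem Stuck.no_path [Finite V] {c : V → V → K} (hs : Stuck c) (hc : Coherent c)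
    {p : Fin 4 → V} (hp : Function.Injective fun i => c (p i) (p i))
    (h01 : Linked c (p 1) (p 0)) (h12 : Linked c (p 1) (p 2)) (h23 : Linked c (p 2) (p 3)) :
    False := by
  classical
  have := Fintype.ofFinite V
  have hne : ∀ i j, i ≠ j → c (p i) (p i) ≠ c (p j) (p j) := fun i j hij h => hij (hp h)
  have hr1 := hs.rank_two hc (hne 1 0 (by decide)) (hne 1 2 (by decide)) (hne 0 2 (by decide))
    h01 h12
  have hr2 := hs.rank_two hc (hne 2 1 (by decide)) (hne 2 3 (by decide)) (hne 1 3 (by decide))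
    (h12.symm hc) h23
  let X : V → Finset V := fun q => Finset.univ.filter fun x => c x x = c q q
  have hX : ∀ q x, x ∈ X q ↔ c x x = c q q := fun q x => by simp [X]
  obtain ⟨A₀, hA₀, hA₀p, hA₀i⟩ := hc.fisher hr1 h01
  obtain ⟨A₂, hA₂, hA₂p, hA₂i⟩ := hc.fisher hr1 h12
  obtain ⟨A₁, hA₁, hA₁p, -⟩ := hc.fisher hr2 (h12.symm hc)
  obtain ⟨A₃, hA₃, hA₃p, hA₃i⟩ := hc.fisher hr2 h23
  have hle : (X (p 2)).card ≤ (X (p 1)).card := by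
    rw [← hA₁]
    exact Finset.card_le_card fun a ha => (hX _ _).2 (hA₁p a ha)
  have hA₂eq : A₂ = X (p 2) := Finset.eq_of_subset_of_card_le
    (fun a ha => (hX _ _).2 (hA₂p a ha)) (by rw [hA₂]; exact hle)
  have hcard2 : (X (p 2)).card = (X (p 1)).card := by rw [← hA₂eq, hA₂]
  have hp1 : p 1 ∈ X (p 1) := (hX _ _).2 rfl
  obtain ⟨q, hq, hqne⟩ := h01.exists_ne hc
  -- The point left out becomes a singleton for free; without this saving the gain would fall short
  -- of four per vertex.
  obtain ⟨K', c', hc', hf, hsep, hlt⟩ := hs ((X (p 1)).erase (p 1))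
    ⟨q, Finset.mem_erase.2 ⟨hqne, (hX _ _).2 hq⟩⟩
  have hsep1 : Separates c' (X (p 1)) := by
    intro s hs u hu
    have h1 : u ∈ X (p 1) := by rw [hX, hf _ _ _ _ hu]; exact (hX _ _).1 hs
    by_cases h2 : s = p 1
    · by_contra h3
      exact h3 (hsep u (Finset.mem_erase.2 ⟨by rwa [h2] at h3, h1⟩) s hu.symm).symm
    · exact hsep s (Finset.mem_erase.2 ⟨h2, hs⟩) u hu
  have hinj0 : Set.InjOn (fun u => c' u u) A₀ := hf.injOn_of_separates hc hc' hsep1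
    fun a ha b hb h => hA₀i a ha b hb fun x hx => h x ((hX _ _).2 hx)
  have hinj2 : Set.InjOn (fun u => c' u u) A₂ := hf.injOn_of_separates hc hc' hsep1
    fun a ha b hb h => hA₂i a ha b hb fun x hx => h x ((hX _ _).2 hx)
  have hsep2 : Separates c' (X (p 2)) := by
    intro s hs u hu
    have h1 : u ∈ X (p 2) := by rw [hX, hf _ _ _ _ hu]; exact (hX _ _).1 hs
    rw [← hA₂eq] at hs h1
    exact hinj2 h1 hs hu
  have hinj3 : Set.InjOn (fun u => c' u u) A₃ := hf.injOn_of_separates hc hc' hsep2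
    fun a ha b hb h => hA₃i a ha b hb fun x hx => h x ((hX _ _).2 hx)
  have hinj1 : Set.InjOn (fun u => c' u u) (X (p 1)) := fun a ha b hb hab => hsep1 b hb a hab
  have := numFibers_add_sum_le hf p hp ![A₀, X (p 1), A₂, A₃]
    (by
      intro i
      fin_cases i
      · exact hA₀p
      · exact fun a ha => (hX _ _).1 ha
      · exact hA₂p
      · exact hA₃p)
    (by
      intro i
      fin_cases i
      · exact hinj0
      · exact hinj1
      · exact hinj2
      · exact hinj3)
  simp only [Fin.sum_univ_four, Matrix.cons_val_zero, Matrix.cons_val_one, Matrix.cons_val,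
    Fintype.card_fin] at this
  have e3 : A₃.card = (X (p 1)).card := by rw [hA₃]; exact hcard2
  have e0 : A₀.card = (X (p 1)).card := hA₀
  have e2 : A₂.card = (X (p 1)).card := hA₂
  rw [Finset.card_erase_of_mem hp1] at hlt
  have hpos : 0 < (X (p 1)).card := Finset.card_pos.2 ⟨_, hp1⟩
  omega

/-- The equivalence relation generated by belonging to the same fiber and being linked. -/
def FiberConnected (c : V → V → K) : V → V → Prop :=
  Relation.ReflTransGen fun u v => c u u = c v v ∨ Linked c u v

theorem Coherent.fiberConnected_equivalence {c : V → V → K} (hc : Coherent c) :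
    Equivalence (FiberConnected c) where
  refl _ := Relation.ReflTransGen.refl
  symm h := by
    induction h with
    | refl => exact Relation.ReflTransGen.refl
    | tail _ h ih =>
      exact Relation.ReflTransGen.head
        (h.elim (fun h => Or.inl h.symm) fun h => Or.inr (h.symm hc)) ih
  trans h h' := Relation.ReflTransGen.trans h h'

theorem FiberConnected.mem_of_closed {c : V → V → K} {C : Set K}
    (hC : ∀ v w, c v v ∈ C → Linked c v w → c w w ∈ C) {u v : V} (hu : c u u ∈ C)
    (h : FiberConnected c u v) : c v v ∈ C := by
  induction h with
  | refl => exact hu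
  | tail _ hbc ih =>
    rcases hbc with hbc | hbc
    · rwa [← hbc]
    · exact hC _ _ ih hbc

/-- If some fiber has two neighbors, these three already form the component: a fourth fiber would
complete a star or a path. Otherwise the component has at most two fibers. -/
theorem Stuck.exists_fibers [Finite V] {c : V → V → K} (hs : Stuck c) (hc : Coherent c) (u : V) :
    ∃ x y z, ∀ v, FiberConnected c u v → c v v = c x x ∨ c v v = c y y ∨ c v v = c z z := by
  have hE := hc.fiberConnected_equivalence
  by_cases h : ∃ x y z, FiberConnected c u x ∧ Linked c x y ∧ Linked c x z ∧ c x x ≠ c y y ∧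
      c x x ≠ c z z ∧ c y y ≠ c z z
  · obtain ⟨x, y, z, hux, hxy, hxz, nxy, nxz, nyz⟩ := h
    refine ⟨x, y, z, fun v hv => ?_⟩
    have hxv := hE.trans (hE.symm hux) hv
    refine hxv.mem_of_closed (C := {κ | κ = c x x ∨ κ = c y y ∨ κ = c z z}) ?_ (Or.inl rfl)
    rintro v w hv hvw
    simp only [Set.mem_ofPred_eq] at hv ⊢
    by_contra! hw
    obtain ⟨w1, w2, w3⟩ := hw
    rcases hv with hv | hv | hv
    · refine hs.no_star hc (u := x) (v := ![y, z, w]) ?_ ?_ ?_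
      · intro i j
        fin_cases i <;> fin_cases j <;>
          simp [nyz, w2, w3, Ne.symm nyz, Ne.symm w2, Ne.symm w3]
      · intro i
        fin_cases i <;> simp [nxy, nxz, Ne.symm w1]
      · intro i
        fin_cases i
        · exact hxy
        · exact hxz
        · exact hvw.congr_left hc hv
    · refine hs.no_path hc (p := ![w, y, x, z]) ?_ (hvw.congr_left hc hv) (hxy.symm hc) hxz
      intro i j
      fin_cases i <;> fin_cases j <;>
        simp [nxy, nxz, nyz, w1, w2, w3, Ne.symm nxy, Ne.symm nxz, Ne.symm nyz, Ne.symm w1,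
          Ne.symm w2, Ne.symm w3]
    · refine hs.no_path hc (p := ![w, z, x, y]) ?_ (hvw.congr_left hc hv) (hxz.symm hc) hxy
      intro i j
      fin_cases i <;> fin_cases j <;>
        simp [nxy, nxz, nyz, w1, w2, w3, Ne.symm nxy, Ne.symm nxz, Ne.symm nyz, Ne.symm w1,
          Ne.symm w2, Ne.symm w3]
  · push Not at h
    by_cases h' : ∃ y, Linked c u y ∧ c u u ≠ c y y
    · obtain ⟨y, huy, nuy⟩ := h'
      refine ⟨u, y, y, fun v hv => ?_⟩
      refine hv.mem_of_closed (C := {κ | κ = c u u ∨ κ = c y y ∨ κ = c y y}) ?_ (Or.inl rfl)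
      rintro v w hv hvw
      simp only [Set.mem_ofPred_eq, or_self] at hv ⊢
      by_contra! hw
      rcases hv with hv | hv
      · exact hw.2 (h u y w (hE.refl u) huy (hvw.congr_left hc hv) nuy hw.1.symm).symm
      · exact hw.1 (h y u w (Relation.ReflTransGen.single (Or.inr huy)) (huy.symm hc)
          (hvw.congr_left hc hv) nuy.symm hw.2.symm).symm
    · push Not at h'
      refine ⟨u, u, u, fun v hv => ?_⟩
      refine hv.mem_of_closed (C := {κ | κ = c u u ∨ κ = c u u ∨ κ = c u u}) ?_ (Or.inl rfl)
      rintro v w hv hvw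
      simp only [Set.mem_ofPred_eq, or_self] at hv ⊢
      exact (h' w (hvw.congr_left hc hv)).symm

theorem Coherent.restrict {c : V → V → K} (hc : Coherent c) {P : V → Prop}
    (hP : ∀ u v, c u u = c v v → P u → P v) :
    Coherent (fun u v : {v // P v} => c u v) where
  diag u v w h := Subtype.ext (hc.diag _ _ _ h)
  symm u v u' v' h := hc.symm _ _ _ _ h
  perm u v u' v' h := by
    obtain ⟨σ, hσ⟩ := hc.perm _ _ _ _ h
    refine ⟨σ.subtypeEquiv fun w => ?_, fun w => hσ w⟩
    have := hc.right (hσ w).1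
    exact ⟨hP _ _ this, hP _ _ this.symm⟩

/-- A refinement of the whole configuration does not lose fibers outside `P`, so the gain inside is
at most the total gain. No closure of the restriction is needed, as `Stuck` asks for some refinement
only. -/
theorem Stuck.restrict [Finite V] {c : V → V → K} (hs : Stuck c) {P : V → Prop}
    (hP : ∀ u v, c u u = c v v → P u → P v) :
    Stuck (fun u v : {v // P v} => c u v) := by
  classical
  intro S hS
  obtain ⟨K', c', hc', hf, hsep, hlt⟩ := hs (S.map (Function.Embedding.subtype P)) (hS.map)
  refine ⟨K', fun u v => c' u v, hc'.restrict fun u v h => hP u v (hf _ _ _ _ h),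
    fun u v u' v' h => hf _ _ _ _ h, fun s hs u hu => ?_, ?_⟩
  · exact Subtype.ext (hsep s (Finset.mem_map_of_mem _ hs) u hu)
  · obtain ⟨A, hA, hAcard, -⟩ := exists_transversal (fun u v : {v // P v} => c' u v)
    have h1 := numFibers_add_card_le hf (A := A.map (Function.Embedding.subtype P)) (by
      intro a ha b hb hab
      simp only [Finset.coe_map, Set.mem_image, Finset.mem_coe] at ha hb
      obtain ⟨a, ha, rfl⟩ := ha
      obtain ⟨b, hb, rfl⟩ := hb
      exact congrArg _ (hA ha hb hab))
    have h2 : ((A.map (Function.Embedding.subtype P)).image fun u => c u u).card ≤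
        numFibers (fun u v : {v // P v} => c u v) := by
      rw [← Set.ncard_coe_finset]
      refine Set.ncard_le_ncard ?_ (Set.finite_range _)
      intro κ hκ
      simp only [Finset.coe_image, Finset.coe_map, Set.mem_image, Finset.mem_coe] at hκ
      obtain ⟨_, ⟨a, _, rfl⟩, rfl⟩ := hκ
      exact ⟨a, rfl⟩
    rw [Finset.card_map] at h1 hlt
    omega

theorem Stuck.identified_of_few_fibers [Finite V] {c : V → V → K} {γ : K → Prop} {k : ℕ}
    (hk : 3 ≤ k) (hs : Stuck c) (hc : Coherent c) (hγ : ∀ u v, γ (c u v) → γ (c v u))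
    (h : ∀ (U : Type u) [Finite U] [Nonempty U] (e : U → U → K), Nat.card U ≤ Nat.card V →
      Stuck e → Coherent e → (∀ u v, γ (e u v) → γ (e v u)) → numFibers e ≤ 3 →
      Identified k e γ) : Identified k c γ := by
  classical
  have hE := hc.fiberConnected_equivalence
  have hinv : ∀ u v u' v', c u u = c u' u' → c v v = c v' v' → FiberConnected c u v →
      FiberConnected c u' v' := fun u v u' v' hu hv huv =>
    hE.trans (hE.trans (Relation.ReflTransGen.single (Or.inl hu.symm)) huv)
      (Relation.ReflTransGen.single (Or.inl hv))
  let E : K → Prop := fun a => ∃ u v, c u v = a ∧ FiberConnected c u v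
  have hEiff : ∀ u v, E (c u v) ↔ FiberConnected c u v := by
    intro u v
    refine ⟨?_, fun h => ⟨u, v, rfl, h⟩⟩
    rintro ⟨u', v', h1, h2⟩
    exact hinv _ _ _ _ (hc.left h1) (hc.right h1) h2
  refine Identified.of_components hk E ?_ ?_ ?_
  · simpa only [hEiff] using hE
  · intro u v u' v' huv _ hu hv
    rw [hEiff] at huv
    rw [hc.eq_of_not_linked (fun h => huv (Relation.ReflTransGen.single (Or.inr h))) hu hv]
  · intro p
    have hP : ∀ u v, c u u = c v v → E (c p u) → E (c p v) := by
      intro u v huv h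
      rw [hEiff] at h ⊢
      exact hinv _ _ _ _ rfl huv h
    have : Nonempty {v // E (c p v)} := ⟨p, (hEiff p p).2 (hE.refl p)⟩
    refine h _ _ (Nat.card_le_card_of_injective _ Subtype.val_injective) (hs.restrict hP)
      (hc.restrict hP) (fun u v => hγ u v) ?_
    obtain ⟨x, y, z, hxyz⟩ := hs.exists_fibers hc p
    refine (Set.ncard_le_ncard (t := ({c x x, c y y, c z z} : Finset K)) ?_
      (Finset.finite_toSet _)).trans ?_
    · rintro _ ⟨v, rfl⟩
      simpa using hxyz v ((hEiff _ _).1 v.2)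
    · rw [Set.ncard_coe_finset]
      exact Finset.card_le_three

end

/-! ### Hitting sets -/

section Hitting

theorem pow_add_mul_le_add_pow (a b q : ℕ) :
    a ^ (q + 1) + (q + 1) * b * a ^ q ≤ (a + b) ^ (q + 1) := by
  induction q with
  | zero => simp
  | succ q ih =>
    calc a ^ (q + 1 + 1) + (q + 1 + 1) * b * a ^ (q + 1)
        ≤ (a ^ (q + 1) + (q + 1) * b * a ^ q) * (a + b) := by
          have : 0 ≤ (q + 1) * b * a ^ q * b := Nat.zero_le _
          ring_nf at this ⊢
          omega
      _ ≤ (a + b) ^ (q + 1) * (a + b) := Nat.mul_le_mul_right _ ih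
      _ = _ := (pow_succ _ _).symm

/-- A counting form of random choice. By Bernoulli, n/θ + 1 random picks miss a given set with
probability at most 1/2; repeating this `T` times beats the union bound over fewer than 2^T sets. -/
theorem exists_hitting_set {V P : Type*} [Fintype V] [Fintype P] (D : P → Finset V) {θ T : ℕ}
    (hθ : 0 < θ) (hD : ∀ p, θ ≤ (D p).card) (hP : Fintype.card P < 2 ^ T) :
    ∃ S : Finset V, S.card ≤ T * (Fintype.card V / θ + 1) ∧ ∀ p, ∃ s ∈ S, s ∈ D p := by
  classical
  rcases isEmpty_or_nonempty P with hemp | ⟨⟨p₀⟩⟩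
  · exact ⟨∅, by simp, fun p => (hemp.false p).elim⟩
  set n := Fintype.card V with hn
  set q := n / θ with hq
  have hθn : θ ≤ n := (hD p₀).trans (Finset.card_le_univ _)
  by_contra! hno
  have hbad : ∀ f : Fin (T * (q + 1)) → V, ∃ p, ∀ i, f i ∉ D p := by
    intro f
    obtain ⟨p, hp⟩ := hno (Finset.univ.image f) (Finset.card_image_le.trans (by simp))
    exact ⟨p, fun i => hp _ (Finset.mem_image_of_mem _ (Finset.mem_univ i))⟩
  have h1 : n ^ (T * (q + 1)) ≤ Fintype.card P * (n - θ) ^ (T * (q + 1)) := by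
    calc n ^ (T * (q + 1)) = (Finset.univ : Finset (Fin (T * (q + 1)) → V)).card := by
          rw [Finset.card_univ, Fintype.card_fun, Fintype.card_fin]
      _ ≤ ((Finset.univ : Finset P).biUnion fun p =>
            Fintype.piFinset fun _ : Fin (T * (q + 1)) => (D p)ᶜ).card := by
          apply Finset.card_le_card
          intro f _
          obtain ⟨p, hp⟩ := hbad f
          simp only [Finset.mem_biUnion, Finset.mem_univ, true_and, Fintype.mem_piFinset,
            Finset.mem_compl]
          exact ⟨p, hp⟩
      _ ≤ Fintype.card P * (n - θ) ^ (T * (q + 1)) := by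
          rw [← Finset.card_univ (α := P)]
          refine Finset.card_biUnion_le_card_mul _ _ _ fun p _ => ?_
          rw [Fintype.card_piFinset_const, Finset.card_compl]
          exact Nat.pow_le_pow_left (Nat.sub_le_sub_left (hD p) _) _
  have h2 : 2 * (n - θ) ^ (q + 1) ≤ n ^ (q + 1) := by
    have h3 := pow_add_mul_le_add_pow (n - θ) θ q
    rw [Nat.sub_add_cancel hθn] at h3
    have h4 : n - θ ≤ (q + 1) * θ := by
      have h5 := Nat.div_add_mod n θ
      have h6 := Nat.mod_lt n hθ
      have h7 : (q + 1) * θ = θ * (n / θ) + θ := by rw [hq]; ring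
      omega
    have h5 := Nat.mul_le_mul_right ((n - θ) ^ q) h4
    have h6 : (n - θ) * (n - θ) ^ q = (n - θ) ^ (q + 1) := by ring
    omega
  have h3 : 2 ^ T * (n - θ) ^ (T * (q + 1)) ≤ n ^ (T * (q + 1)) := by
    have := Nat.pow_le_pow_left h2 T
    rwa [mul_pow, ← pow_mul, ← pow_mul, mul_comm (q + 1)] at this
  have hpos : 0 < n ^ (T * (q + 1)) := pow_pos (by omega) _
  rcases Nat.eq_zero_or_pos ((n - θ) ^ (T * (q + 1))) with h0 | h0
  · rw [h0] at h1; omega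
  · have := Nat.mul_lt_mul_of_pos_right hP h0
    omega

end Hitting

/-! ### Balls in a graph, and scattered sets -/

section Balls

variable {V : Type u}

/-- There is an `F`-walk from `u` to `w` of length at most `j`. -/
def Within (F : V → V → Prop) : ℕ → V → V → Prop
  | 0, u, w => u = w
  | j + 1, u, w => ∃ z, Within F j u z ∧ (z = w ∨ F z w)

variable {F : V → V → Prop}

theorem Within.succ {j : ℕ} {u w : V} (h : Within F j u w) : Within F (j + 1) u w :=
  ⟨w, h, Or.inl rfl⟩

theorem Within.mono {i j : ℕ} {u w : V} (h : Within F i u w) (hij : i ≤ j) : Within F j u w := by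
  induction j, hij using Nat.le_induction with
  | base => exact h
  | succ j _ ih => exact ih.succ

theorem Within.trans {i j : ℕ} {u v w : V} (h : Within F i u v) (h' : Within F j v w) :
    Within F (i + j) u w := by
  induction j generalizing w with
  | zero => cases h'; exact h
  | succ j ih =>
    obtain ⟨z, hz, hzw⟩ := h'
    exact ⟨z, ih hz, hzw⟩

theorem Within.symm (hF : ∀ u v, F u v → F v u) {j : ℕ} {u w : V} (h : Within F j u w) :
    Within F j w u := by
  induction j generalizing w with
  | zero => exact Eq.symm h
  | succ j ih =>
    obtain ⟨z, hz, hzw⟩ := h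
    have h1 : Within F 1 w z := ⟨w, rfl, hzw.elim (fun h => Or.inl h.symm) fun h => Or.inr (hF _ _ h)⟩
    have := h1.trans (ih hz)
    rwa [add_comm] at this

theorem within_equivalence (hF : ∀ u v, F u v → F v u) :
    Equivalence fun u v => ∃ j, Within F j u v where
  refl _ := ⟨0, rfl⟩
  symm := fun ⟨j, h⟩ => ⟨j, h.symm hF⟩
  trans := fun ⟨_, h⟩ ⟨_, h'⟩ => ⟨_, h.trans h'⟩

theorem Within.of_stable {j : ℕ} {u : V} (h : ∀ w, Within F (j + 1) u w → Within F j u w)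
    {i : ℕ} {w : V} (hw : Within F i u w) : Within F j u w := by
  induction i generalizing w with
  | zero => exact Within.mono (i := 0) hw (Nat.zero_le _)
  | succ i ih =>
    obtain ⟨z, hz, hzw⟩ := hw
    exact h w ⟨z, ih hz, hzw⟩

open Classical in
theorem card_within_le [Fintype V] {η : ℕ} (hη : ∀ x, (Finset.univ.filter (F x)).card ≤ η)
    (j : ℕ) (u : V) : (Finset.univ.filter (Within F j u)).card ≤ (η + 1) ^ j := by
  induction j with
  | zero =>
    have : Finset.univ.filter (Within F 0 u) = {u} := by
      ext w
      simp only [Finset.mem_filter, Finset.mem_univ, true_and, Finset.mem_singleton]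
      exact eq_comm
    simp [this]
  | succ j ih =>
    have : Finset.univ.filter (Within F (j + 1) u) ⊆
        (Finset.univ.filter (Within F j u)).biUnion fun z => insert z (Finset.univ.filter (F z)) := by
      intro w hw
      obtain ⟨z, hz, hzw⟩ := (Finset.mem_filter.1 hw).2
      simp only [Finset.mem_biUnion, Finset.mem_filter, Finset.mem_univ, true_and,
        Finset.mem_insert]
      exact ⟨z, hz, hzw.imp Eq.symm id⟩
    refine (Finset.card_le_card this).trans ((Finset.card_biUnion_le_card_mul _ _ (η + 1)
      fun z _ => (Finset.card_insert_le _ _).trans (Nat.succ_le_succ (hη z))).trans ?_)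
    rw [pow_succ]
    exact Nat.mul_le_mul_right _ ih

theorem Coherent.within_congr {K : Type v} {c : V → V → K} (hc : Coherent c)
    (hF : ∀ u v u' v', c u v = c u' v' → F u v → F u' v') {j : ℕ} {u v u' v' : V}
    (h : c u v = c u' v') (huv : Within F j u v) : Within F j u' v' := by
  induction j generalizing v v' with
  | zero =>
    cases huv
    exact hc.diag _ _ _ h.symm
  | succ j ih =>
    obtain ⟨z, hz, hzv⟩ := huv
    obtain ⟨σ, hσ⟩ := hc.perm _ _ _ _ h
    refine ⟨σ z, ih (hσ z).1 hz, ?_⟩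
    rcases hzv with rfl | hzv
    · exact Or.inl (hc.diag _ _ _ (hσ z).2.symm)
    · exact Or.inr (hF _ _ _ _ (hσ z).2 hzv)

/-- `w` has distance `j` from `u`. -/
def AtDist (F : V → V → Prop) (j : ℕ) (u w : V) : Prop :=
  Within F j u w ∧ ∀ i < j, ¬ Within F i u w

theorem exists_atDist_of_not_stable {u : V} {m : ℕ}
    (h : ∀ j < m, ∃ w, Within F (j + 1) u w ∧ ¬ Within F j u w) :
    ∀ j ≤ m, ∃ w, AtDist F j u w := by
  intro j hj
  cases j with
  | zero => exact ⟨u, rfl, fun i hi => absurd hi (Nat.not_lt_zero i)⟩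
  | succ j =>
    obtain ⟨w, h1, h2⟩ := h j hj
    exact ⟨w, h1, fun i hi h3 => h2 (h3.mono (Nat.lt_succ_iff.1 hi))⟩

/-- A scattered subset of `B` whose balls cover `B`. -/
theorem exists_scattered [Fintype V] (F : V → V → Prop) (hF : ∀ u v, F u v → F v u)
    (B : Finset V) :
    ∃ S ⊆ B, (∀ u ∈ S, ∀ v ∈ S, Within F 8 u v → u = v) ∧ ∀ v ∈ B, ∃ u ∈ S, Within F 8 u v := by
  classical
  let 𝒮 := B.powerset.filter fun S => ∀ u ∈ S, ∀ v ∈ S, Within F 8 u v → u = v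
  obtain ⟨S, hS, hmax⟩ := Finset.exists_max_image 𝒮 Finset.card
    ⟨∅, by simp [𝒮]⟩
  obtain ⟨h1, h2⟩ := Finset.mem_filter.1 hS
  rw [Finset.mem_powerset] at h1
  refine ⟨S, h1, h2, fun v hv => ?_⟩
  by_contra! hno
  have hvS : v ∉ S := fun h => hno v h (Within.mono (i := 0) rfl (Nat.zero_le _))
  have := hmax (insert v S) (by
    refine Finset.mem_filter.2 ⟨Finset.mem_powerset.2 (Finset.insert_subset hv h1), ?_⟩
    intro a ha b hb hab
    rcases Finset.mem_insert.1 ha with ha' | ha' <;> rcases Finset.mem_insert.1 hb with hb' | hb'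
    · rw [ha', hb']
    · subst ha'; exact (hno b hb' (hab.symm hF)).elim
    · subst hb'; exact (hno a ha' hab).elim
    · exact h2 a ha' b hb' hab)
  rw [Finset.card_insert_of_notMem hvS] at this
  omega

/-- Around each `u ∈ S` take vertices at distances 0 to 4. Balls of radius 4 about distinct points
of `S` are disjoint, and a fiber determines the distances to individualized vertices, so all these
vertices lie in different fibers. -/
theorem Coherent.card_scattered_le [Fintype V] {K : Type v} {c : V → V → K} (hc : Coherent c)
    (hF : ∀ u v, F u v → F v u)
    (hFc : ∀ u v u' v', c u v = c u' v' → F u v → F u' v') {S S' : Finset V}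
    (hsep : Separates c S') (hSS' : S ⊆ S')
    (hS : ∀ u ∈ S, ∀ v ∈ S, Within F 8 u v → u = v)
    (hbig : ∀ u ∈ S, ∀ j < 4, ∃ w, Within F (j + 1) u w ∧ ¬ Within F j u w) :
    5 * S.card ≤ numFibers c := by
  classical
  have h : ∀ u ∈ S, ∀ j : Fin 5, ∃ w, AtDist F j u w := fun u hu j =>
    exists_atDist_of_not_stable (hbig u hu) j (Nat.lt_succ_iff.1 j.2)
  choose! w hw using h
  have key : ∀ u ∈ S, ∀ j : Fin 5, ∀ u' ∈ S, ∀ j' : Fin 5,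
      c (w u j) (w u j) = c (w u' j') (w u' j') → u = u' ∧ j = j' := by
    intro u hu j u' hu' j' h
    have h1 := hc.eq_of_separates hsep (hSS' hu) h
    have h2 : ∀ i, Within F i u (w u j) ↔ Within F i u (w u' j') := fun i =>
      ⟨fun h => (hc.within_congr hFc h1 (h.symm hF)).symm hF,
        fun h => (hc.within_congr hFc h1.symm (h.symm hF)).symm hF⟩
    have h3 := (hw u hu j).1.mono (Nat.lt_succ_iff.1 j.2)
    have h4 := (hw u' hu' j').1.mono (Nat.lt_succ_iff.1 j'.2)
    have h5 := hS u hu u' hu' (((h2 _).1 h3).trans (h4.symm hF))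
    subst h5
    refine ⟨rfl, ?_⟩
    rcases lt_trichotomy j j' with h6 | h6 | h6
    · exact ((hw u hu j').2 j h6 ((h2 _).1 (hw u hu j).1)).elim
    · exact h6
    · exact ((hw u hu j).2 j' h6 ((h2 _).2 (hw u hu j').1)).elim
  have hinj : Set.InjOn (fun p : V × Fin 5 => w p.1 p.2) ↑(S ×ˢ (Finset.univ : Finset (Fin 5))) := by
    rintro ⟨u, j⟩ hp ⟨u', j'⟩ hp' h
    simp only [Finset.coe_product, Set.mem_prod, Finset.mem_coe] at hp hp'
    obtain ⟨h1, h2⟩ := key u hp.1 j u' hp'.1 j' (by change w u j = w u' j' at h; rw [h])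
    rw [h1, h2]
  have := card_le_numFibers (c := c) (A := (S ×ˢ (Finset.univ : Finset (Fin 5))).image
      fun p => w p.1 p.2) (by
    intro a ha b hb hab
    simp only [Finset.coe_image, Set.mem_image, Finset.coe_product, Set.mem_prod,
      Finset.mem_coe] at ha hb
    obtain ⟨⟨u, j⟩, ⟨hu, -⟩, rfl⟩ := ha
    obtain ⟨⟨u', j'⟩, ⟨hu', -⟩, rfl⟩ := hb
    obtain ⟨h1, h2⟩ := key u hu j u' hu' j' hab
    rw [h1, h2])
  rw [Finset.card_image_of_injOn hinj, Finset.card_product, Finset.card_univ,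
    Fintype.card_fin] at this
  omega

end Balls

/-! ### Complementing densely joined pairs of fibers -/

section Majority

open Classical in
/-- The fiber of `u`. -/
noncomputable def fiber {V : Type u} {K : Type v} [Fintype V] (c : V → V → K) (u : V) : Finset V :=
  Finset.univ.filter fun w => c w w = c u u

open Classical in
/-- At least half of the pairs between the fibers of `u` and `w` are adjacent. -/
def Majority {V : Type u} {K : Type v} [Fintype V] (adj : V → V → Prop) (c : V → V → K)
    (u w : V) : Prop :=
  (fiber c u).card * (fiber c w).card ≤
    2 * ((fiber c u ×ˢ fiber c w).filter fun p => adj p.1 p.2).card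

/-- The graph in which adjacency is complemented between fibers that are joined densely. -/
def Flipped {V : Type u} {K : Type v} [Fintype V] (adj : V → V → Prop) (c : V → V → K)
    (u w : V) : Prop := ¬ (adj u w ↔ Majority adj c u w)

variable {V : Type u} {K : Type v} [Fintype V] {adj : V → V → Prop} {c : V → V → K}

theorem mem_fiber {u w : V} : w ∈ fiber c u ↔ c w w = c u u := by simp [fiber]

theorem fiber_congr {u u' : V} (h : c u u = c u' u') : fiber c u = fiber c u' := by
  ext w; simp [mem_fiber, h]

theorem majority_congr {u w u' w' : V} (hu : c u u = c u' u') (hw : c w w = c w' w') :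
    Majority adj c u w ↔ Majority adj c u' w' := by
  rw [Majority, Majority, fiber_congr hu, fiber_congr hw]

theorem Majority.symm (hadj : ∀ u w, adj u w → adj w u) {u w : V} (h : Majority adj c u w) :
    Majority adj c w u := by
  classical
  rw [Majority] at h ⊢
  rw [mul_comm, ← Finset.card_map (Equiv.prodComm V V).toEmbedding]
  refine h.trans (Nat.mul_le_mul_left _ (Finset.card_le_card ?_))
  rintro ⟨a, b⟩ hab
  simp only [Finset.mem_filter, Finset.mem_product] at hab
  simp only [Finset.mem_map_equiv, Finset.mem_filter, Finset.mem_product]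
  exact ⟨⟨hab.1.2, hab.1.1⟩, hadj _ _ hab.2⟩

theorem Flipped.symm (hadj : ∀ u w, adj u w → adj w u) {u w : V} (h : Flipped adj c u w) :
    Flipped adj c w u := by
  intro h'
  exact h ((Iff.intro (hadj u w) (hadj w u)).trans
    (h'.trans (Iff.intro (fun h => h.symm hadj) fun h => h.symm hadj)))

theorem Coherent.flipped_congr (hc : Coherent c)
    (hadj : ∀ u v u' v', c u v = c u' v' → (adj u v ↔ adj u' v')) {u w u' w' : V}
    (h : c u w = c u' w') : Flipped adj c u w ↔ Flipped adj c u' w' := by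
  rw [Flipped, Flipped, hadj _ _ _ _ h, majority_congr (hc.left h) (hc.right h)]

open Classical in
theorem Coherent.card_adj_congr (hc : Coherent c)
    (hadj : ∀ u v u' v', c u v = c u' v' → (adj u v ↔ adj u' v')) {u w w' : V}
    (h : c w w = c w' w') :
    ((fiber c u).filter fun a => adj a w).card = ((fiber c u).filter fun a => adj a w').card := by
  obtain ⟨σ, hσ⟩ := hc.perm _ _ _ _ h
  refine Finset.card_equiv σ fun a => ?_
  simp only [Finset.mem_filter, mem_fiber]
  rw [hc.left (hσ a).2, hadj _ _ _ _ (hσ a).2]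

-- All vertices of one fiber have equally many neighbors in another, so a majority among pairs is a
-- majority at each single vertex.
open Classical in
theorem Coherent.majority_iff (hc : Coherent c)
    (hadj : ∀ u v u' v', c u v = c u' v' → (adj u v ↔ adj u' v')) {u w : V} :
    Majority adj c u w ↔
      (fiber c u).card ≤ 2 * ((fiber c u).filter fun a => adj a w).card := by
  have h1 : ((fiber c u ×ˢ fiber c w).filter fun p => adj p.1 p.2).card =
      ((fiber c u).filter fun a => adj a w).card * (fiber c w).card := by
    rw [Finset.card_filter, Finset.sum_product_right]
    rw [Finset.sum_congr rfl fun b hb => show _ = ((fiber c u).filter fun a => adj a w).card by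
      rw [← hc.card_adj_congr hadj (mem_fiber.1 hb), Finset.card_filter]]
    rw [Finset.sum_const, smul_eq_mul, mul_comm]
  have hpos : 0 < (fiber c w).card := Finset.card_pos.2 ⟨w, mem_fiber.2 rfl⟩
  rw [Majority, h1, ← mul_assoc]
  exact ⟨fun h => Nat.le_of_mul_le_mul_right h hpos, fun h => Nat.mul_le_mul_right _ h⟩

open Classical in
theorem Coherent.two_mul_card_flipped_le (hc : Coherent c)
    (hadj : ∀ u v u' v', c u v = c u' v' → (adj u v ↔ adj u' v')) (u w : V) :
    2 * ((fiber c u).filter fun a => Flipped adj c a w).card ≤ (fiber c u).card := by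
  have h1 : ∀ a ∈ fiber c u, (Flipped adj c a w ↔ ¬ (adj a w ↔ Majority adj c u w)) := by
    intro a ha
    rw [Flipped, majority_congr (mem_fiber.1 ha) rfl]
  rw [Finset.filter_congr h1]
  have h2 := Finset.card_filter_add_card_filter_not (s := fiber c u) (fun a => adj a w)
  have h3 := hc.majority_iff hadj (u := u) (w := w)
  by_cases h : Majority adj c u w
  · have h4 := h3.1 h
    simp only [h, iff_true]
    omega
  · have h4 := mt h3.2 h
    simp only [h, iff_false, not_not]
    omega

open Classical in
/-- If vertices of the same fiber have nearly the same neighbors, the flipped graph is sparse. -/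
theorem Coherent.card_flipped_le (hc : Coherent c)
    (hadj : ∀ u v u' v', c u v = c u' v' → (adj u v ↔ adj u' v')) {η : ℕ}
    (hη : ∀ u v, c u u = c v v →
      (Finset.univ.filter fun w => ¬ (adj u w ↔ adj v w)).card ≤ η) (u : V) :
    (Finset.univ.filter (Flipped adj c u)).card ≤ η := by
  set B := fiber c u with hB
  have hpos : 0 < B.card := Finset.card_pos.2 ⟨u, mem_fiber.2 rfl⟩
  have hdeg : ∀ a ∈ B, (Finset.univ.filter (Flipped adj c a)).card =
      (Finset.univ.filter (Flipped adj c u)).card := by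
    intro a ha
    obtain ⟨σ, hσ⟩ := hc.perm _ _ _ _ (mem_fiber.1 ha)
    refine Finset.card_equiv σ fun w => ?_
    simp only [Finset.mem_filter, Finset.mem_univ, true_and]
    exact hc.flipped_congr hadj (hσ w).1
  have h1 : ∑ w : V, (B.filter fun a => Flipped adj c a w).card =
      B.card * (Finset.univ.filter (Flipped adj c u)).card := by
    simp only [Finset.card_filter]
    rw [Finset.sum_comm, Finset.sum_congr rfl fun a ha => show _ =
      (Finset.univ.filter (Flipped adj c u)).card by rw [← hdeg a ha, Finset.card_filter]]
    rw [Finset.sum_const, smul_eq_mul, Finset.card_filter]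
  -- The flipped vertices `X` form at most half of `B`, and each of them disagrees at `w` with every
  -- vertex of the other part `Y`. Summing over `w` counts the discrepancies of all ordered pairs in
  -- `B`.
  have h2 : ∀ w : V, B.card * (B.filter fun a => Flipped adj c a w).card ≤
      ((B ×ˢ B).filter fun p => ¬ (adj p.1 w ↔ adj p.2 w)).card := by
    intro w
    set X := B.filter fun a => Flipped adj c a w with hX
    set Y := B.filter fun a => ¬ Flipped adj c a w with hY
    have hXY : X.card + Y.card = B.card := Finset.card_filter_add_card_filter_not _
    have h3 : 2 * X.card ≤ B.card := hc.two_mul_card_flipped_le hadj u w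
    have hdiff : ∀ a ∈ X, ∀ b ∈ Y, ¬ (adj a w ↔ adj b w) := by
      intro a ha b hb h
      obtain ⟨ha1, ha2⟩ := Finset.mem_filter.1 ha
      obtain ⟨hb1, hb2⟩ := Finset.mem_filter.1 hb
      apply hb2
      rw [Flipped, ← h, majority_congr (u' := a) ((mem_fiber.1 hb1).trans (mem_fiber.1 ha1).symm)
        rfl]
      exact ha2
    have hdisj : Disjoint (X ×ˢ Y) (Y ×ˢ X) := by
      rw [Finset.disjoint_left]
      rintro ⟨a, b⟩ h4 h5
      exact (Finset.mem_filter.1 (Finset.mem_product.1 h5).1).2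
        (Finset.mem_filter.1 (Finset.mem_product.1 h4).1).2
    calc B.card * X.card ≤ X.card * Y.card + Y.card * X.card := by
          have : B.card ≤ Y.card + Y.card := by omega
          calc B.card * X.card ≤ (Y.card + Y.card) * X.card := Nat.mul_le_mul_right _ this
            _ = _ := by ring
      _ = (X ×ˢ Y ∪ Y ×ˢ X).card := by
          rw [Finset.card_union_of_disjoint hdisj, Finset.card_product, Finset.card_product]
      _ ≤ _ := by
          apply Finset.card_le_card
          rintro ⟨a, b⟩ hab
          simp only [Finset.mem_union, Finset.mem_product] at hab
          simp only [Finset.mem_filter, Finset.mem_product]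
          rcases hab with ⟨ha, hb⟩ | ⟨ha, hb⟩
          · exact ⟨⟨Finset.mem_of_mem_filter _ ha, Finset.mem_of_mem_filter _ hb⟩,
              hdiff a ha b hb⟩
          · exact ⟨⟨Finset.mem_of_mem_filter _ ha, Finset.mem_of_mem_filter _ hb⟩,
              fun h => hdiff b hb a ha h.symm⟩
  have h3 : ∑ w : V, ((B ×ˢ B).filter fun p => ¬ (adj p.1 w ↔ adj p.2 w)).card ≤
      B.card * B.card * η := by
    simp only [Finset.card_filter]
    rw [Finset.sum_comm, ← Finset.card_product, ← smul_eq_mul]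
    refine Finset.sum_le_card_nsmul _ _ _ fun p hp => ?_
    rw [← Finset.card_filter]
    obtain ⟨hp1, hp2⟩ := Finset.mem_product.1 hp
    exact hη _ _ ((mem_fiber.1 hp1).trans (mem_fiber.1 hp2).symm)
  have h4 : B.card * (B.card * (Finset.univ.filter (Flipped adj c u)).card) ≤
      B.card * (B.card * η) := by
    rw [← h1, Finset.mul_sum, ← mul_assoc]
    exact (Finset.sum_le_sum fun w _ => h2 w).trans h3
  exact Nat.le_of_mul_le_mul_left (Nat.le_of_mul_le_mul_left h4 hpos) hpos

end Majority

/-! ### Symmetric differences of neighborhoods -/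

section Discrepancy

variable {V : Type u} {K : Type v} [Fintype V]

open Classical in
/-- The vertices on which the neighborhoods of `u` and `v` differ. -/
noncomputable def discrepancy (γ : K → Prop) (c : V → V → K) (u v : V) : Finset V :=
  Finset.univ.filter fun w => ¬ (γ (c u w) ↔ γ (c v w))

theorem Coherent.card_discrepancy_congr {c : V → V → K} (hc : Coherent c) (γ : K → Prop)
    {u v u' v' : V} (h : c u v = c u' v') :
    (discrepancy γ c u v).card = (discrepancy γ c u' v').card := by
  obtain ⟨σ, hσ⟩ := hc.perm _ _ _ _ h
  refine Finset.card_equiv σ fun w => ?_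
  simp only [discrepancy, Finset.mem_filter, Finset.mem_univ, true_and]
  rw [(hσ w).1, hc.symm _ _ _ _ (hσ w).2]

/-- Individualizing `u` splits the fiber of `v` by color towards `u`; five colors would mean four
new fibers. -/
theorem Stuck.card_image_le [DecidableEq K] {c : V → V → K} (hs : Stuck c) (hc : Coherent c)
    (u v : V) : ((fiber c v).image fun w => c u w).card ≤ 4 := by
  classical
  obtain ⟨B, hB, hBinj, hBimg⟩ : ∃ B ⊆ fiber c v, Set.InjOn (fun w => c u w) B ∧
      B.image (fun w => c u w) = (fiber c v).image fun w => c u w := by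
    choose g hg hgu using fun κ : (fiber c v).image fun w => c u w => Finset.mem_image.1 κ.2
    refine ⟨Finset.univ.image g, ?_, ?_, ?_⟩
    · intro w hw
      obtain ⟨κ, -, rfl⟩ := Finset.mem_image.1 hw
      exact hg κ
    · intro a ha b hb hab
      obtain ⟨κ, -, rfl⟩ := Finset.mem_image.1 (Finset.mem_coe.1 ha)
      obtain ⟨κ', -, rfl⟩ := Finset.mem_image.1 (Finset.mem_coe.1 hb)
      simp only [hgu] at hab
      rw [Subtype.ext hab]
    · ext κ
      constructor
      · intro hκ
        obtain ⟨_, ha, rfl⟩ := Finset.mem_image.1 hκ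
        obtain ⟨κ', -, rfl⟩ := Finset.mem_image.1 ha
        rw [hgu]; exact κ'.2
      · intro hκ
        exact Finset.mem_image.2 ⟨g ⟨κ, hκ⟩, Finset.mem_image_of_mem _ (Finset.mem_univ _),
          hgu ⟨κ, hκ⟩⟩
  rw [← hBimg, Finset.card_image_of_injOn hBinj]
  obtain ⟨K', c', hc', hf, hsep, hlt⟩ := hs {u} (Finset.singleton_nonempty u)
  have := numFibers_add_sum_le (ι := Unit) hf (fun _ => v) (fun _ _ _ => rfl) (fun _ => B)
    (fun _ a ha => mem_fiber.1 (hB ha))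
    (fun _ => hf.injOn_of_separates hc hc' hsep fun a ha b hb h =>
      hBinj ha hb (h u (Finset.mem_singleton_self u)))
  simp at this hlt
  omega

/-- The size of a discrepancy depends only on the color of the pair. Pairs inside a fiber can be
moved to start at a fixed representative, where at most four colors occur. -/
theorem Stuck.exists_discrepancies {c : V → V → K} (hs : Stuck c) (hc : Coherent c)
    (γ : K → Prop) : ∃ D : Finset ℕ, D.card ≤ 4 * numFibers c ∧
      ∀ u v, c u u = c v v → (discrepancy γ c u v).card ∈ D := by
  classical
  obtain ⟨A, -, hAcard, hA⟩ := exists_transversal c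
  refine ⟨A.biUnion fun a => (fiber c a).image fun w => (discrepancy γ c a w).card, ?_, ?_⟩
  · rw [← hAcard, mul_comm]
    refine Finset.card_biUnion_le_card_mul _ _ _ fun a _ => ?_
    refine le_trans ?_ (hs.card_image_le hc a a)
    obtain hemp | ⟨⟨κ₀⟩⟩ := isEmpty_or_nonempty K
    · exact (hemp.false (c a a)).elim
    let g : K → ℕ := fun κ =>
      if h : ∃ w, c a w = κ then (discrepancy γ c a h.choose).card else 0
    have : ((fiber c a).image fun w => (discrepancy γ c a w).card) ⊆
        ((fiber c a).image fun w => c a w).image g := by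
      intro m hm
      obtain ⟨w, hw, rfl⟩ := Finset.mem_image.1 hm
      refine Finset.mem_image.2 ⟨c a w, Finset.mem_image_of_mem _ hw, ?_⟩
      have h : ∃ w', c a w' = c a w := ⟨w, rfl⟩
      simp only [g, dif_pos h]
      exact hc.card_discrepancy_congr γ h.choose_spec
    exact (Finset.card_le_card this).trans Finset.card_image_le
  · intro u v huv
    obtain ⟨a, ha, hau⟩ := hA u
    obtain ⟨σ, hσ⟩ := hc.perm _ _ _ _ hau.symm
    refine Finset.mem_biUnion.2 ⟨a, ha, Finset.mem_image.2 ⟨σ v, ?_, ?_⟩⟩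
    · rw [mem_fiber, ← hc.right (hσ v).1, ← huv, hau]
    · exact (hc.card_discrepancy_congr γ (hσ v).1).symm

/-- Pigeonhole: of `D.card + 1` disjoint intervals between consecutive scales, one misses `D`. -/
theorem exists_gap (θ : ℕ → ℕ) (hθ : StrictMono θ) (D : Finset ℕ) :
    ∃ i ≤ D.card, ∀ d ∈ D, d < θ (i + 1) → d < θ i := by
  classical
  by_contra! h
  choose! g hgD hg1 hg2 using h
  have hinj : Set.InjOn g (Finset.range (D.card + 1)) := by
    intro i hi j hj hij
    have hi' := Nat.lt_succ_iff.1 (Finset.mem_range.1 (Finset.mem_coe.1 hi))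
    have hj' := Nat.lt_succ_iff.1 (Finset.mem_range.1 (Finset.mem_coe.1 hj))
    have h1 := hg1 i hi'
    have h2 := hg2 i hi'
    have h3 := hg1 j hj'
    have h4 := hg2 j hj'
    rw [hij] at h1 h2
    have h5 := hθ.lt_iff_lt.1 (h4.trans_lt h1)
    have h6 := hθ.lt_iff_lt.1 (h2.trans_lt h3)
    omega
  have := Finset.card_le_card_of_injOn g (s := Finset.range (D.card + 1)) (t := D)
    (fun i hi => hgD i (Nat.lt_succ_iff.1 (Finset.mem_range.1 hi))) hinj
  simp at this

end Discrepancy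

/-! ### Bounding the number of pebbles -/

section

variable {V : Type u} {K : Type v}

/-- Individualize a hitting set for the large discrepancies, flip, and split along the components of
the flipped graph. The vertices of the scattered set are never pebbled: they only serve to bound the
component size. -/
theorem Stuck.identified_of_gap [Fintype V] [Nonempty V] {c : V → V → K} {γ : K → Prop}
    (hs : Stuck c) (hc : Coherent c) (hγ : ∀ u v, γ (c u v) → γ (c v u)) (h3 : numFibers c ≤ 3)
    {η θ T : ℕ} (hθ : 0 < θ)
    (hgap : ∀ u v, c u u = c v v → (discrepancy γ c u v).card < θ →
      (discrepancy γ c u v).card < η) (hT : Fintype.card V ^ 2 < 2 ^ T) :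
    ∃ s ≤ T * (Fintype.card V / θ + 1), Identified (3 + (3 + 4 * s) * (η + 1) ^ 8 + s) c γ := by
  classical
  obtain ⟨S, hScard, hS⟩ := exists_hitting_set
    (P := {p : V × V // θ ≤ (discrepancy γ c p.1 p.2).card})
    (fun p => discrepancy γ c p.1.1 p.1.2) hθ (fun p => p.2) (T := T) (by
      refine (Fintype.card_subtype_le _).trans_lt ?_
      rwa [Fintype.card_prod, ← sq])
  refine ⟨S.card, hScard, ?_⟩
  obtain ⟨K₁, y, π, hy, hπ, hsep, hI, hmin⟩ := exists_individualized hc S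
  have hyc : Finer y c := fun u v u' v' h => by rw [← hπ, ← hπ, h]
  refine hI _ γ (by omega) ?_
  let adj : V → V → Prop := fun u v => γ (c u v)
  have hadj : ∀ u v u' v', y u v = y u' v' → (adj u v ↔ adj u' v') := fun u v u' v' h => by
    simp only [adj, hyc _ _ _ _ h]
  let F := Flipped adj y
  have hF : ∀ u v, F u v → F v u := fun u v h => h.symm hγ
  have hFy : ∀ u v u' v', y u v = y u' v' → F u v → F u' v' := fun u v u' v' h =>
    (hy.flipped_congr hadj h).1
  have hdeg : ∀ u, (Finset.univ.filter (F u)).card ≤ η := by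
    refine hy.card_flipped_le hadj fun u v huv => ?_
    refine (hgap u v (hyc _ _ _ _ huv) ?_).le
    -- A large discrepancy would contain an individualized vertex, but vertices of one fiber have
    -- the same color towards it.
    by_contra! hle
    obtain ⟨s, hs, hsd⟩ := hS ⟨(u, v), hle⟩
    simp only [discrepancy, Finset.mem_filter, Finset.mem_univ, true_and] at hsd
    apply hsd
    rw [hyc _ _ _ _ (hy.eq_of_separates hsep hs huv)]
  let big : V → Prop := fun u => ∀ j < 4, ∃ w, Within F (j + 1) u w ∧ ¬ Within F j u w
  obtain ⟨S', hS'big, hS'sc, hS'cov⟩ := exists_scattered F hF (Finset.univ.filter big)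
  -- Individualizing `S ∪ S'` gives at least 5|S'| fibers, while stuckness allows fewer than 3 +
  -- 4|S| + 4|S'|.
  have hS'card : S'.card ≤ 3 + 4 * S.card := by
    rcases (S ∪ S').eq_empty_or_nonempty with hemp | hne
    · have : S' = ∅ := Finset.subset_empty.1 (hemp ▸ Finset.subset_union_right)
      simp [this]
    · obtain ⟨K', c', hc', hf, hsep', hlt⟩ := hs _ hne
      have hfy : Finer c' y := hmin K' c' hc' hf fun s hs =>
        hsep' s (Finset.mem_union_left _ hs)
      have h5 := hc'.card_scattered_le hF (fun u v u' v' h => hFy _ _ _ _ (hfy _ _ _ _ h)) hsep'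
        Finset.subset_union_right hS'sc fun u hu => (Finset.mem_filter.1 (hS'big hu)).2
      have := Finset.card_union_le S S'
      omega
  have hpow : 1 ≤ (η + 1) ^ 8 := Nat.one_le_pow _ _ (Nat.succ_pos _)
  have hcomp : ∀ p, (Finset.univ.filter fun v => ∃ j, Within F j p v).card ≤
      (3 + 4 * S.card) * (η + 1) ^ 8 := by
    intro p
    have hE := within_equivalence hF
    -- Either some ball of radius below 4 is already the whole component, or the component is
    -- covered by the 8-balls about `S'`.
    by_cases h : ∃ u, (∃ j, Within F j p u) ∧ ¬ big u
    · obtain ⟨u, hpu, hu⟩ := h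
      simp only [big] at hu
      push Not at hu
      obtain ⟨j, hj, hstab⟩ := hu
      calc _ ≤ (Finset.univ.filter (Within F j u)).card := by
            apply Finset.card_le_card
            intro v hv
            simp only [Finset.mem_filter, Finset.mem_univ, true_and] at hv ⊢
            obtain ⟨i, hi⟩ := hE.trans (hE.symm hpu) hv
            exact hi.of_stable hstab
        _ ≤ (η + 1) ^ j := card_within_le hdeg j u
        _ ≤ (η + 1) ^ 8 := Nat.pow_le_pow_right (Nat.succ_pos _) (by omega)
        _ ≤ _ := Nat.le_mul_of_pos_left _ (by omega)
    · push Not at h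
      calc _ ≤ (S'.biUnion fun u => Finset.univ.filter (Within F 8 u)).card := by
            apply Finset.card_le_card
            intro v hv
            obtain ⟨j, hj⟩ := (Finset.mem_filter.1 hv).2
            obtain ⟨u, hu, huv⟩ := hS'cov v (Finset.mem_filter.2 ⟨Finset.mem_univ _, h v ⟨j, hj⟩⟩)
            exact Finset.mem_biUnion.2 ⟨u, hu, Finset.mem_filter.2 ⟨Finset.mem_univ _, huv⟩⟩
        _ ≤ S'.card * (η + 1) ^ 8 :=
            Finset.card_biUnion_le_card_mul _ _ _ fun u _ => card_within_le hdeg 8 u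
        _ ≤ _ := Nat.mul_le_mul_right _ hS'card
  let E : K₁ → Prop := fun a => ∃ u v, y u v = a ∧ ∃ j, Within F j u v
  have hEiff : ∀ u v, E (y u v) ↔ ∃ j, Within F j u v := by
    intro u v
    refine ⟨?_, fun h => ⟨u, v, rfl, h⟩⟩
    rintro ⟨u', v', h, j, hj⟩
    exact ⟨j, hy.within_congr hFy h hj⟩
  refine Identified.of_components (by omega) E ?_ ?_ ?_
  · simpa only [hEiff] using within_equivalence hF
  · intro u v u' v' huv huv' hu hv
    have hnot : ∀ a b, ¬ E (y a b) → (adj a b ↔ Majority adj y a b) := by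
      intro a b hab
      by_contra h
      exact hab ((hEiff a b).2 ⟨1, a, rfl, Or.inr h⟩)
    simp only [hπ]
    exact (hnot u v huv).trans ((majority_congr hu hv).trans (hnot u' v' huv').symm)
  · intro p
    have : Nonempty {v // E (y p v)} := ⟨p, (hEiff p p).2 ⟨0, rfl⟩⟩
    apply Identified.of_card_le
    have h1 := hcomp p
    rw [← Fintype.card_subtype, ← Nat.card_eq_fintype_card] at h1
    rw [Nat.card_congr (Equiv.subtypeEquivRight fun v => hEiff p v)]
    omega

theorem bound_of_scale {n T e s H η : ℕ} (hT : 2 ≤ T) (he : 10 ≤ e) (hη : η = T ^ e)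
    (hH : H = (η + 1) ^ 8) (hs : s ≤ T * (n / T ^ (10 * e) + 1)) :
    T * (3 + (3 + 4 * s) * H + s) ≤ 5 * n + 11 * T ^ (10 * e) := by
  have h1 : η + 1 ≤ T ^ (e + 1) := by
    have : 1 ≤ T ^ e := Nat.one_le_pow _ _ (by omega)
    calc η + 1 ≤ T ^ e * 2 := by omega
      _ ≤ T ^ e * T := Nat.mul_le_mul_left _ hT
      _ = _ := (pow_succ _ _).symm
  -- The factor 10 between consecutive exponents absorbs the eighth power of η + 1 and two more
  -- factors `T`, since 8(e + 1) + 2 ≤ 10e.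
  have h2 : T * T * H ≤ T ^ (10 * e) := by
    calc T * T * H ≤ T * T * (T ^ (e + 1)) ^ 8 := by
          rw [hH]; exact Nat.mul_le_mul_left _ (Nat.pow_le_pow_left h1 8)
      _ = T ^ (8 * e + 10) := by ring
      _ ≤ _ := Nat.pow_le_pow_right (by omega) (by omega)
  have hH1 : 1 ≤ H := by rw [hH]; exact Nat.one_le_pow _ _ (Nat.succ_pos _)
  set θ := T ^ (10 * e) with hθ
  have h3 : T * (s * H) ≤ n + θ := by
    calc T * (s * H) ≤ T * (T * (n / θ + 1) * H) := by gcongr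
      _ = (T * T * H) * (n / θ) + T * T * H := by ring
      _ ≤ θ * (n / θ) + θ := by gcongr
      _ ≤ n + θ := Nat.add_le_add_right (Nat.mul_div_le n θ) _
  have h4 : T * H ≤ θ := le_trans
    (Nat.mul_le_mul_right H (Nat.le_mul_of_pos_right T (by omega))) h2
  have h5 : T * s ≤ T * (s * H) := Nat.mul_le_mul_left _ (Nat.le_mul_of_pos_right _ hH1)
  have h6 : T ≤ T * H := Nat.le_mul_of_pos_right _ hH1
  calc T * (3 + (3 + 4 * s) * H + s) = 3 * T + 3 * (T * H) + 4 * (T * (s * H)) + T * s := by ring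
    _ ≤ 5 * n + 11 * θ := by omega

theorem Stuck.identified_of_numFibers_le [Fintype V] [Nonempty V] {c : V → V → K} {γ : K → Prop}
    (hs : Stuck c) (hc : Coherent c) (hγ : ∀ u v, γ (c u v) → γ (c v u)) (h3 : numFibers c ≤ 3)
    {T n E : ℕ} (hE : 10 ^ 14 ≤ E) (hT2 : 2 ≤ T) (hn : Fintype.card V ≤ n) (hT : n ^ 2 < 2 ^ T) :
    Identified ((5 * n + 11 * T ^ E) / T) c γ := by
  obtain ⟨D, hD, hmem⟩ := hs.exists_discrepancies hc γ
  have hmono : StrictMono fun i : ℕ => T ^ 10 ^ (i + 1) := fun i j hij =>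
    Nat.pow_lt_pow_right (by omega) (Nat.pow_lt_pow_right (by norm_num) (by omega))
  obtain ⟨i, hi, hgap⟩ := exists_gap _ hmono D
  obtain ⟨s, hsle, hI⟩ := hs.identified_of_gap hc hγ h3 (η := T ^ 10 ^ (i + 1))
    (θ := T ^ 10 ^ (i + 1 + 1)) (pow_pos (by omega) _) (fun u v huv => hgap _ (hmem u v huv))
    (T := T) (lt_of_le_of_lt (Nat.pow_le_pow_left hn 2) hT)
  refine hI.mono ?_
  rw [Nat.le_div_iff_mul_le (by omega), mul_comm]
  have he : 10 ≤ 10 ^ (i + 1) := by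
    calc 10 = 10 ^ 1 := by norm_num
      _ ≤ _ := Nat.pow_le_pow_right (by norm_num) (by omega)
  have hexp : 10 ^ (i + 1 + 1) = 10 * 10 ^ (i + 1) := by rw [pow_succ, mul_comm]
  rw [hexp] at hsle
  refine (bound_of_scale hT2 he rfl rfl hsle).trans ?_
  rw [← hexp]
  refine Nat.add_le_add (Nat.mul_le_mul_left _ hn) (Nat.mul_le_mul_left _ ?_)
  -- At most three fibers give at most twelve sizes, so `i ≤ 12` and the upper scale has exponent at
  -- most 10^14.
  exact Nat.pow_le_pow_right (by omega)
    ((Nat.pow_le_pow_right (by norm_num) (by omega)).trans hE)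

theorem Coherent.identified [Fintype V] [Nonempty V] {c : V → V → K} {γ : K → Prop}
    (hc : Coherent c) (hγ : ∀ u v, γ (c u v) → γ (c v u)) {T E : ℕ}
    (hE : 10 ^ 14 ≤ E) (hT2 : 2 ≤ T) (hT : Fintype.card V ^ 2 < 2 ^ T) :
    Identified ((5 * Fintype.card V + 11 * T ^ E) / T + Fintype.card V / 4) c γ := by
  classical
  set n := Fintype.card V with hn
  set b := (5 * n + 11 * T ^ E) / T with hb
  have hb3 : 3 ≤ b := by
    rw [hb, Nat.le_div_iff_mul_le (by omega)]
    have : T ^ 1 ≤ T ^ E := Nat.pow_le_pow_right (by omega) (le_trans (by norm_num) hE)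
    rw [pow_one] at this
    omega
  let P : ℕ → Prop := fun s => ∃ (K' : Type v) (c' : V → V → K') (π : K' → K), Coherent c' ∧
    (∀ u v, π (c' u v) = c u v) ∧ 4 * s ≤ numFibers c' ∧
    ∀ k, 3 ≤ k → Identified k c' (fun a => γ (π a)) → Identified (k + s) c γ
  have hP0 : P 0 := ⟨K, c, id, hc, fun _ _ => rfl, by simp, fun k _ h => h⟩
  have hPle : ∀ s, P s → s ≤ n / 4 := by
    rintro s ⟨K', c', π, -, -, h, -⟩
    have h1 : numFibers c' ≤ n := by
      obtain ⟨A, -, hA, -⟩ := exists_transversal c'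
      rw [← hA]; exact Finset.card_le_univ A
    omega
  -- A maximal number of profitably pebbled vertices forces the configuration to be stuck, as any
  -- further profitable set would enlarge it.
  have hspec := Nat.findGreatest_spec (P := P) (Nat.zero_le (n / 4)) hP0
  set s := Nat.findGreatest P (n / 4) with hs
  obtain ⟨K', c', π, hc', hπ, hfib, hI⟩ := hspec
  have hstuck : Stuck c' := by
    intro S hS
    obtain ⟨K'', c'', π', h1, h2, h3, h4, -⟩ := exists_individualized hc' S
    refine ⟨K'', c'', h1, fun u v u' v' h => by rw [← h2, ← h2, h], h3, ?_⟩
    by_contra! hge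
    have hP : P (s + S.card) := by
      refine ⟨K'', c'', fun a => π (π' a), h1, fun u v => by
        change π (π' (c'' u v)) = c u v
        rw [h2, hπ], by omega,
        fun k hk h => ?_⟩
      have := hI (k + S.card) (by omega) (h4 k _ hk h)
      rwa [add_assoc, add_comm S.card s] at this
    have := Nat.le_findGreatest (hPle _ hP) hP
    have hpos := hS.card_pos
    omega
  have hγ' : ∀ u v, γ (π (c' u v)) → γ (π (c' v u)) := fun u v => by
    rw [hπ, hπ]; exact hγ u v
  have hId : Identified b c' (fun a => γ (π a)) := by
    refine hstuck.identified_of_few_fibers hb3 hc' hγ' ?_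
    intro U _ _ e hU he hce hγe h3
    have := Fintype.ofFinite U
    exact he.identified_of_numFibers_le hce hγe h3 hE hT2
      (by rwa [Nat.card_eq_fintype_card, Nat.card_eq_fintype_card] at hU) hT
  exact (hI b hb3 hId).mono (Nat.add_le_add_left (Nat.findGreatest_le _) _)

end

end Rainbow

/-! ### From Weisfeiler–Leman to the pebble game -/

namespace WL

section

variable {V W : Type u} {C : Type v} [Fintype V] [Fintype W]

/-- The color of a pair of vertices given by equality, adjacency and the colors of both. -/
def pairColor (G : SimpleGraph V) (χ : V → C) (u v : V) : Prop × Prop × C × C :=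
  (u = v, G.Adj u v, χ u, χ v)

theorem exists_equiv_of_map_eq {A : Type*} {f : V → A} {g : W → A}
    (h : (Finset.univ : Finset V).val.map f = (Finset.univ : Finset W).val.map g) :
    ∃ σ : V ≃ W, ∀ v, g (σ v) = f v := by
  classical
  have key : ∀ a, Nonempty ({v // f v = a} ≃ {w // g w = a}) := by
    intro a
    have := congrArg (Multiset.count a) h
    rw [Multiset.count_map, Multiset.count_map] at this
    rw [← Fintype.card_eq, Fintype.card_subtype, Fintype.card_subtype]
    simpa [Finset.card_def, eq_comm] using this
  let e := fun a => (key a).some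
  exact ⟨Equiv.ofFiberEquiv e, fun v => Equiv.ofFiberEquiv_map e v⟩

theorem atomicType_eq_of_roundColoring_eq {k : ℕ} {G : SimpleGraph V} {χ : V → C}
    {H : SimpleGraph W} {ψ : W → C} {x : Fin k → V} {y : Fin k → W} (i : ℕ)
    (h : roundColoring k G χ i x = roundColoring k H ψ i y) :
    atomicType G χ x = atomicType H ψ y := by
  induction i with
  | zero => exact h
  | succ i ih => exact ih (congrArg Prod.fst h)

/-- Equality of colors at the stable round is the back-and-forth system. Equal outputs force equal
stable rounds, and by stability agreement persists one round further, where equality of the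
multisets is Duplicator's bijection. -/
theorem pebbleEquiv_of_not_distinguishes [Nonempty V] {k : ℕ} (hk : 2 ≤ k) {G : SimpleGraph V}
    {χ : V → C} {H : SimpleGraph W} {ψ : W → C} (h : ¬ Distinguishes k G χ H ψ) :
    Rainbow.PebbleEquiv k (pairColor G χ) (pairColor H ψ) := by
  classical
  rw [Distinguishes, not_not] at h
  have hex : ∀ x, ∃ y, coloring k H ψ y = coloring k G χ x := by
    intro x
    have : coloring k G χ x ∈ (Finset.univ : Finset (Fin k → W)).val.map (coloring k H ψ) := by
      rw [← h]; exact Multiset.mem_map_of_mem _ (Finset.mem_univ x)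
    obtain ⟨y, -, hy⟩ := Multiset.mem_map.1 this
    exact ⟨y, hy⟩
  have hi : stableRound k H ψ = stableRound k G χ := by
    obtain ⟨y, hy⟩ := hex fun _ => Classical.arbitrary V
    exact Nat.succ_injective (congrArg Sigma.fst hy)
  have hG : Equivalent (roundColoring k G χ (stableRound k G χ))
      (roundColoring k G χ (stableRound k G χ + 1)) := Nat.sInf_mem (exists_stableRound k G χ)
  have hH : Equivalent (roundColoring k H ψ (stableRound k H ψ))
      (roundColoring k H ψ (stableRound k H ψ + 1)) := Nat.sInf_mem (exists_stableRound k H ψ)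
  have hex' : ∀ x, ∃ y, roundColoring k G χ (stableRound k G χ + 1) x =
      roundColoring k H ψ (stableRound k G χ + 1) y := by
    intro x
    obtain ⟨y, hy⟩ := hex x
    refine ⟨y, ?_⟩
    simp only [coloring] at hy
    rw [hi, Sigma.mk.injEq] at hy
    exact (eq_of_heq hy.2).symm
  rw [hi] at hH
  set i := stableRound k G χ
  have hnext : ∀ x y, roundColoring k G χ i x = roundColoring k H ψ i y →
      roundColoring k G χ (i + 1) x = roundColoring k H ψ (i + 1) y := by
    intro x y hxy
    -- Stability is known within each graph only, so `x` is first matched with some `z` of `H` and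
    -- then compared with `y` there.
    obtain ⟨z, hz⟩ := hex' x
    rw [hz]
    apply hH.1
    rw [← hxy]
    exact (congrArg Prod.fst hz).symm
  refine ⟨fun x y => roundColoring k G χ i x = roundColoring k H ψ i y, ⟨?_, ?_, ?_⟩, ?_⟩
  · intro x y hxy a b
    have := atomicType_eq_of_roundColoring_eq i hxy
    simp only [atomicType, Prod.mk.injEq, funext_iff] at this
    simp only [pairColor, Prod.mk.injEq]
    exact ⟨this.2.1 a b, this.2.2 a b, this.1 a, this.1 b⟩
  · intro x y hxy a b
    have := atomicType_eq_of_roundColoring_eq i hxy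
    simp only [atomicType, Prod.mk.injEq, funext_iff] at this
    exact iff_of_eq (this.2.1 a b)
  · intro x y hxy
    have h1 := congrArg Prod.snd (hnext x y hxy)
    simp only [roundColoring, substitutes, if_neg (show k ≠ 1 by omega)] at h1
    obtain ⟨σ, hσ⟩ := exists_equiv_of_map_eq h1
    exact ⟨σ, fun w j => (congrFun (hσ w) j).symm⟩
  · obtain ⟨y, hy⟩ := hex' fun _ => Classical.arbitrary V
    exact ⟨_, y, congrArg Prod.fst hy⟩

theorem identifies_of_identified [Nonempty V] {k : ℕ} (hk : 2 ≤ k) {G : SimpleGraph V} {χ : V → C}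
    (h : Rainbow.Identified k (pairColor G χ) fun a => a.2.1) : Identifies k G χ := by
  intro W _ _ H ψ hno
  by_contra hdist
  obtain ⟨φ, h1, h2⟩ := h W _ (pebbleEquiv_of_not_distinguishes hk hdist)
  exact hno ⟨⟨φ, fun {a b} => h2 a b⟩, fun x => congrArg (fun p => p.2.2.1) (h1 x)⟩

theorem identifies_of_lt_pow [Nonempty V] (G : SimpleGraph V) (χ : V → C) {T E : ℕ}
    (hE : 10 ^ 14 ≤ E) (hT2 : 2 ≤ T) (hT : Fintype.card V ^ 2 < 2 ^ T) :
    Identifies ((5 * Fintype.card V + 11 * T ^ E) / T + Fintype.card V / 4) G χ := by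
  have hk : 3 ≤ (5 * Fintype.card V + 11 * T ^ E) / T + Fintype.card V / 4 := by
    refine le_trans ?_ (Nat.le_add_right _ _)
    rw [Nat.le_div_iff_mul_le (by omega)]
    have : T ^ 1 ≤ T ^ E := Nat.pow_le_pow_right (by omega) (le_trans (by norm_num) hE)
    rw [pow_one] at this
    omega
  apply identifies_of_identified (by omega)
  obtain ⟨K', c', π, hcl⟩ := Rainbow.exists_closure (pairColor G χ) (by
    intro u v w h
    have := congrArg Prod.fst h
    simpa [pairColor] using this)
  refine hcl.identified hk (hcl.coherent.identified ?_ hE hT2 hT)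
  intro u v
  simp only [hcl.proj]
  exact fun h => SimpleGraph.Adj.symm h

end

/-! ### The sublinear error term and the final bound -/

/-- A sublinear error term. -/
noncomputable def errorTerm (E n : ℕ) : ℝ :=
  n * (5 / ((2 * Nat.log 2 n + 2 : ℕ) : ℝ)) + 11 * ((2 * Nat.log 2 n + 2 : ℕ) : ℝ) ^ E

theorem errorTerm_isLittleO (E : ℕ) : errorTerm E =o[atTop] (fun n : ℕ => (n : ℝ)) := by
  have hlog : Tendsto (fun n : ℕ => ((2 * Nat.log 2 n + 2 : ℕ) : ℝ)) atTop atTop := by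
    refine tendsto_natCast_atTop_atTop.comp (tendsto_atTop.2 fun b => ?_)
    filter_upwards [eventually_ge_atTop (2 ^ b)] with n hn
    have := Nat.le_log_of_pow_le (b := 2) (by norm_num) hn
    omega
  have h1 : (fun n : ℕ => (n : ℝ) * (5 / ((2 * Nat.log 2 n + 2 : ℕ) : ℝ))) =o[atTop]
      (fun n : ℕ => (n : ℝ)) := by
    have := (isBigO_refl (fun n : ℕ => (n : ℝ)) atTop).mul_isLittleO
      ((isLittleO_one_iff ℝ).2 (hlog.const_div_atTop 5))
    simpa using this
  have h2 : (fun n : ℕ => ((2 * Nat.log 2 n + 2 : ℕ) : ℝ)) =O[atTop]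
      (fun n : ℕ => Real.log n) := by
    refine IsBigO.of_bound 6 ?_
    filter_upwards [eventually_ge_atTop 3] with n hn
    have h3 : (1 : ℝ) ≤ Real.log n := by
      rw [Real.le_log_iff_exp_le (by positivity)]
      have : (3 : ℝ) ≤ n := by exact_mod_cast hn
      linarith [Real.exp_one_lt_d9]
    have h4 : (Nat.log 2 n : ℝ) * Real.log 2 ≤ Real.log n := by
      rw [← Real.log_pow]
      apply Real.log_le_log (by positivity)
      exact_mod_cast Nat.pow_log_le_self 2 (by omega)
    have h5 := Real.log_two_gt_d9
    have h6 : (0 : ℝ) ≤ Nat.log 2 n := Nat.cast_nonneg _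
    rw [Real.norm_of_nonneg (by positivity), Real.norm_of_nonneg (by linarith)]
    push_cast
    nlinarith
  have h3 := (h2.pow E).trans_isLittleO
    ((Real.isLittleO_pow_log_id_atTop (n := E)).comp_tendsto tendsto_natCast_atTop_atTop)
  exact h1.add (h3.const_mul_left 11)

end WL

theorem theorem1 :
    ∃ f : ℕ → ℝ, f =o[atTop] (fun n : ℕ => (n : ℝ)) ∧
      ∀ (V : Type u) [Fintype V] [Nonempty V] (C : Type v) (G : SimpleGraph V) (χ : V → C),
        ∃ d : ℕ, WL.dimension G χ = (d : ℕ∞) ∧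
          (d : ℝ) ≤ (Fintype.card V : ℝ) / 4 + f (Fintype.card V) := by
  -- The exponent is kept as a variable, so that only its lower bound is ever used.
  obtain ⟨E, hE⟩ : ∃ E : ℕ, 10 ^ 14 ≤ E := ⟨_, le_rfl⟩
  refine ⟨WL.errorTerm E, WL.errorTerm_isLittleO E, fun V _ _ C G χ => ?_⟩
  set n := Fintype.card V with hn
  -- Logarithmic in n, yet large enough for 2^T to exceed the number n² of pairs to be hit.
  set T := 2 * Nat.log 2 n + 2 with hT
  have hlt : n ^ 2 < 2 ^ T := by
    have := Nat.lt_pow_succ_log_self (b := 2) (by norm_num) n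
    calc n ^ 2 < (2 ^ (Nat.log 2 n + 1)) ^ 2 := Nat.pow_lt_pow_left this (by norm_num)
      _ = 2 ^ T := by rw [← pow_mul, hT]; ring_nf
  have hI := WL.identifies_of_lt_pow G χ hE (T := T) (by omega) hlt
  rw [← hn] at hI
  set k := (5 * n + 11 * T ^ E) / T + n / 4 with hk
  have hk1 : 1 ≤ k := by
    refine le_trans ?_ (Nat.le_add_right _ _)
    rw [Nat.le_div_iff_mul_le (by omega)]
    have : T ^ 1 ≤ T ^ E := Nat.pow_le_pow_right (by omega) (le_trans (by norm_num) hE)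
    rw [pow_one] at this
    omega
  have hle : WL.dimension G χ ≤ (k : ℕ∞) := sInf_le ⟨k, rfl, hk1, hI⟩
  obtain ⟨d, hd⟩ := ENat.ne_top_iff_exists.1 (ne_top_of_le_ne_top (ENat.natCast_ne_top k) hle)
  refine ⟨d, hd.symm, ?_⟩
  rw [← hd, Nat.cast_le] at hle
  have hTpos : (1 : ℝ) ≤ (T : ℝ) := by exact_mod_cast (by omega : 1 ≤ T)
  calc (d : ℝ) ≤ k := by exact_mod_cast hle
    _ ≤ ((5 * n + 11 * T ^ E : ℕ) : ℝ) / T + (n : ℝ) / 4 := by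
        rw [hk, Nat.cast_add]
        exact add_le_add Nat.cast_div_le (by exact_mod_cast Nat.cast_div_le (α := ℝ))
    _ ≤ (n : ℝ) / 4 + WL.errorTerm E n := by
        rw [WL.errorTerm, ← hT, Nat.cast_add, add_div, Nat.cast_mul, Nat.cast_mul, Nat.cast_pow]
        have h1 : ((11 : ℕ) : ℝ) * (T : ℝ) ^ E / T ≤ 11 * (T : ℝ) ^ E :=
          div_le_self (by positivity) hTpos
        have h2 : ((5 : ℕ) : ℝ) * n / T = n * (5 / T) := by push_cast; ring
        rw [h2]
        linarith
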